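/- Consider the inviscid nonlocal system on the real line \[ u_t = 2uv,\qquad v_t = H(u^2),\qquad u(\cdot,0)=u_0,\quad v(\cdot,0)=v_0, \] where $u,v$ are real-valued and $H$ is the Hilbert transform $(Hf)(x)=\frac1\pi\,\mathrm{P.V.}\int_{-\infty}^{\infty}\frac{f(y)}{x-y}\,dy$. Let $H^1=H^1(\mathbb R)$ be the real Sobolev space with norm $\|f\|_{H^1}=(\|f\|_{L^2}^2+\|f'\|_{L^2}^2)^{1/2}$. For $0<T<\infty$, a solution on $[0,T)$ is a pair $u,v\in C^1([0,T);H^1)$ with $u(0)=u_0$, $v(0)=v_0$ that satisfies the two equations for all $t\in[0,T)$ and almost every $x$, the time derivatives being taken in $H^1$. (Local well-posedness.) For any $u_0,v_0\in H^1$ there is a finite time $T=T(\|u_0\|_{H^1},\|v_0\|_{H^1})>0$, depending only on the two norms, such that the system has a solution on $[0,T)$. Solutions are unique: two solutions on the same interval $[0,S)$ with the same initial data coincide there. (Blow-up criterion.) Let $0<T<\infty$ and let $(u,v)$ be a solution on $[0,T)$. If $T$ is the maximal time of existence in $H^1$, that is, if for no $S>T$ there is a solution on $[0,S)$ with the same initial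 data, then \[ \int_0^T\bigl(\|u(t)\|_{L^\infty}+\|v(t)\|_{L^\infty}\bigr)\,dt=+\infty . \] -/

import Mathlib

open MeasureTheory Set Filter Topology
open scoped ContDiff ENNReal

noncomputable section

namespace NonlocalSystem

/-- The real space `L²(ℝ)` for Lebesgue measure. -/
abbrev L2 : Type := Lp ℝ 2 (volume : Measure ℝ)

/-- `g` is the weak derivative of `f` on the real line, tested against smooth functions with
compact support. -/
def IsWeakDeriv (f g : ℝ → ℝ) : Prop :=
  ∀ φ : ℝ → ℝ, ContDiff ℝ ∞ φ → HasCompactSupport φ →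
    ∫ x, f x * deriv φ x = -∫ x, g x * φ x

theorem integrable_mul_of_test (f : L2) {ψ : ℝ → ℝ} (hc : Continuous ψ)
    (hs : HasCompactSupport ψ) : Integrable (fun x => f x * ψ x) :=
  MemLp.integrable_mul (p := 2) (q := 2) (Lp.memLp f) (hc.memLp_of_hasCompactSupport hs)

theorem integral_add_mul (f g : L2) {ψ : ℝ → ℝ} (hc : Continuous ψ)
    (hs : HasCompactSupport ψ) :
    ∫ x, (f + g : L2) x * ψ x = (∫ x, f x * ψ x) + ∫ x, g x * ψ x := by
  rw [← integral_add (integrable_mul_of_test f hc hs) (integrable_mul_of_test g hc hs)]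
  refine integral_congr_ae ?_
  filter_upwards [Lp.coeFn_add f g] with x hx
  rw [hx, Pi.add_apply, add_mul]

theorem integral_smul_mul (c : ℝ) (f : L2) (ψ : ℝ → ℝ) :
    ∫ x, (c • f : L2) x * ψ x = c * ∫ x, f x * ψ x := by
  rw [← integral_const_mul]
  refine integral_congr_ae ?_
  filter_upwards [Lp.coeFn_smul c f] with x hx
  rw [hx, Pi.smul_apply, smul_eq_mul, mul_assoc]

theorem integral_zero_mul (ψ : ℝ → ℝ) : ∫ x, (0 : L2) x * ψ x = 0 := by
  have h := integral_smul_mul 0 (0 : L2) ψ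
  rwa [zero_smul, zero_mul] at h

/-- The Sobolev space `H¹(ℝ)`, realised as the graph of the weak derivative in `L² × L²`: its
elements are the pairs `(f, f')` with `f, f' ∈ L²` and `f'` the weak derivative of `f`.  The norm
inherited from the `ℓ²`-product is the usual one, `‖f‖² = ‖f‖²_{L²} + ‖f'‖²_{L²}`. -/
def sobolevH1 : Submodule ℝ (WithLp 2 (L2 × L2)) where
  carrier := {p | IsWeakDeriv p.fst p.snd}
  zero_mem' := by
    intro φ _ _
    have h1 := integral_zero_mul (deriv φ)
    have h2 := integral_zero_mul φ
    simp only [WithLp.zero_fst, WithLp.zero_snd]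
    rw [h1, h2, neg_zero]
  add_mem' := by
    intro p q hp hq φ hφ hs
    have hd : Continuous (deriv φ) := hφ.continuous_deriv (by simp)
    have h1 := integral_add_mul p.fst q.fst hd hs.deriv
    have h2 := integral_add_mul p.snd q.snd hφ.continuous hs
    simp only [WithLp.add_fst, WithLp.add_snd]
    rw [h1, h2, hp φ hφ hs, hq φ hφ hs, neg_add]
  smul_mem' := by
    intro c p hp φ hφ hs
    have h1 := integral_smul_mul c p.fst (deriv φ)
    have h2 := integral_smul_mul c p.snd φ
    simp only [WithLp.smul_fst, WithLp.smul_snd]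
    rw [h1, h2, hp φ hφ hs, mul_neg]

/-- The real Sobolev space `H¹(ℝ)` as a normed space. -/
abbrev H1 : Type := sobolevH1

/-- An element of `H¹(ℝ)` regarded as a function on the line, defined almost everywhere. -/
instance : CoeFun H1 (fun _ => ℝ → ℝ) := ⟨fun f => (f.1.fst : ℝ → ℝ)⟩

/-- `HasHilbertTransformAt f x l`: the principal value
`(1/π) P.V. ∫ f(y) / (x - y) dy` exists and equals `l`; the truncated integrals are required to
converge absolutely. -/
def HasHilbertTransformAt (f : ℝ → ℝ) (x l : ℝ) : Prop :=
  (∀ ε > 0, IntegrableOn (fun y => f y / (x - y)) {y | ε ≤ |x - y|}) ∧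
    Tendsto (fun ε : ℝ => (1 / Real.pi) * ∫ y in {y | ε ≤ |x - y|}, f y / (x - y))
      (𝓝[>] 0) (𝓝 l)

/-- `(u, v)` is a solution of `u_t = 2 u v`, `v_t = H(u²)` with initial data `(u₀, v₀)` in the
class `C¹([0,T); H¹)`: time derivatives are taken in the norm of `H¹` (one-sided at `t = 0`), and
the equations are equalities of functions of `x` almost everywhere, at every time `t`. -/
structure IsSolution (u₀ v₀ : H1) (T : ℝ) (u v : ℝ → H1) : Prop where
  contDiffOn_u : ContDiffOn ℝ 1 u (Ico 0 T)
  contDiffOn_v : ContDiffOn ℝ 1 v (Ico 0 T)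
  eq_u : ∀ t ∈ Ico 0 T, ∀ᵐ x : ℝ,
    (derivWithin u (Ico 0 T) t) x = 2 * (u t) x * (v t) x
  eq_v : ∀ t ∈ Ico 0 T, ∀ᵐ x : ℝ,
    HasHilbertTransformAt (fun y => (u t) y ^ 2) x ((derivWithin v (Ico 0 T) t) x)
  init_u : u 0 = u₀
  init_v : v 0 = v₀

/-- `(u, v)` is a solution on `[0,T)` and `T < ∞` is the maximal time of existence in `H¹`: there
is no solution with the same initial data on any longer interval `[0,S)`. -/
def IsMaximalSolution (u₀ v₀ : H1) (T : ℝ) (u v : ℝ → H1) : Prop :=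
  0 < T ∧ IsSolution u₀ v₀ T u v ∧
    ∀ S > T, ¬ ∃ u' v' : ℝ → H1, IsSolution u₀ v₀ S u' v'

end NonlocalSystem

end

/-! On `H1 × H1` the system is an ordinary differential equation `z' = B z z` with `B` bounded and
bilinear (`systemL`). Boundedness needs two facts: `H1` is an algebra, and the Hilbert transform
does not increase the `H1` norm of a product. Given these, Picard–Lindelöf yields a solution for a
time depending only on the size of the data, and local Lipschitz continuity yields uniqueness.

For the blow-up criterion, the product estimate is linear in the `H1` norms with sup norms as
coefficients: `‖B z z‖ ≤ 4 (‖u‖_∞ + ‖v‖_∞) ‖z‖`. If the time integral of the sup norms were finite,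
Grönwall would bound `‖z‖` on `[0,T)`. A restart close to `T`, with a step depending only on that
bound, would then pass `T`.

The Hilbert transform is treated without Fourier analysis. Convolution with the conjugate Poisson
kernel commutes with weak differentiation. This kernel has the same autocorrelation as the Poisson
kernel, so both convolutions have the same `L²` norm, at most `π` times that of the function. Hence
the regularised transforms are bounded in `H1` and have a weak limit point. Elements of `H1` are
Hölder continuous of order 1/2, so the symmetrised singular integral converges pointwise, for
truncations and for conjugate Poisson kernels, to the same value. The weak limit is therefore the
principal value. -/

namespace NonlocalSystem

/-! ### Quadratic differential equations in a normed space -/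

section QuadraticODE

open scoped NNReal

variable {E : Type*} [NormedAddCommGroup E] [NormedSpace ℝ E]

theorem norm_quadratic_sub_le (B : E →L[ℝ] E →L[ℝ] E) (z w : E) :
    ‖B z z - B w w‖ ≤ ‖B‖ * (‖z‖ + ‖w‖) * ‖z - w‖ := by
  have h : B z z - B w w = B (z - w) z + B w (z - w) := by simp
  rw [h]
  calc ‖B (z - w) z + B w (z - w)‖ ≤ ‖B‖ * ‖z - w‖ * ‖z‖ + ‖B‖ * ‖w‖ * ‖z - w‖ :=
        (norm_add_le _ _).trans (add_le_add (B.le_opNorm₂ _ _) (B.le_opNorm₂ _ _))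
    _ = ‖B‖ * (‖z‖ + ‖w‖) * ‖z - w‖ := by ring

theorem lipschitzOnWith_quadratic (B : E →L[ℝ] E →L[ℝ] E) (R : ℝ≥0) :
    LipschitzOnWith (2 * ‖B‖₊ * R) (fun z => B z z) {z | ‖z‖ ≤ R} := by
  refine LipschitzOnWith.of_dist_le_mul fun z hz w hw => ?_
  rw [dist_eq_norm, dist_eq_norm]
  refine (norm_quadratic_sub_le B z w).trans ?_
  simp only [mem_ofPred_eq] at hz hw
  push_cast
  have : ‖B‖ * (‖z‖ + ‖w‖) ≤ ‖B‖ * (R + R) := by gcongr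
  calc _ ≤ ‖B‖ * (R + R) * ‖z - w‖ := by gcongr
    _ = _ := by ring

/-- Local solvability of a quadratic differential equation, with a time that depends only on a
bound for the initial value. -/
theorem exists_quadratic_solution [CompleteSpace E] (B : E →L[ℝ] E →L[ℝ] E) (M : ℝ) :
    ∃ τ > 0, ∀ x₀ : E, ‖x₀‖ ≤ M → ∀ t₀ : ℝ, ∃ x : ℝ → E, x t₀ = x₀ ∧
      ∀ t ∈ Icc t₀ (t₀ + τ), HasDerivWithinAt x (B (x t) (x t)) (Icc t₀ (t₀ + τ)) t := by
  -- The unit ball around any datum of norm at most `M` lies in the ball of radius `R`, where the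
  -- speed is at most `L = ‖B‖ R²`. In time `1 / (L + 1)` the solution cannot leave the unit ball.
  set R : ℝ≥0 := M.toNNReal + 1 with hR
  set L : ℝ≥0 := ‖B‖₊ * R * R with hL
  refine ⟨1 / (L + 1), by positivity, fun x₀ hx₀ t₀ => ?_⟩
  have hτ : (0 : ℝ) ≤ 1 / (L + 1) := by positivity
  have hball : Metric.closedBall x₀ ((1 : ℝ≥0) : ℝ) ⊆ {z | ‖z‖ ≤ R} := by
    intro z hz
    rw [mem_closedBall_iff_norm] at hz
    have h1 : ‖z‖ ≤ ‖x₀‖ + ‖z - x₀‖ := by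
      simpa using norm_add_le x₀ (z - x₀)
    have h2 : M ≤ M.toNNReal := Real.le_coe_toNNReal M
    simp only [mem_ofPred_eq, hR]
    push_cast at hz ⊢
    linarith
  have hpl : IsPicardLindelof (fun _ z => B z z)
      (⟨t₀, left_mem_Icc.2 (by linarith)⟩ : Icc t₀ (t₀ + 1 / (L + 1))) x₀ 1 0 L
      (2 * ‖B‖₊ * R) := by
    refine IsPicardLindelof.of_time_independent (fun z hz => ?_)
      ((lipschitzOnWith_quadratic B R).mono hball) ?_
    · have hz' : ‖z‖ ≤ R := hball hz
      refine (B.le_opNorm₂ z z).trans ?_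
      simp only [hL]
      push_cast
      gcongr
    · simp only [add_sub_cancel_left, sub_self, NNReal.coe_one, NNReal.coe_zero, sub_zero]
      rw [max_eq_left hτ, mul_one_div, div_le_one (by positivity)]
      linarith
  exact hpl.exists_eq_forall_mem_Icc_hasDerivWithinAt₀

theorem hasDerivWithinAt_Ici_of_Ico {x : ℝ → E} {x' : E} {a b t : ℝ} (ht : t ∈ Ico a b)
    (h : HasDerivWithinAt x x' (Ico a b) t) : HasDerivWithinAt x x' (Ici t) t :=
  h.mono_of_mem_nhdsWithin (mem_of_superset (Ico_mem_nhdsGE ht.2) (Ico_subset_Ico_left ht.1))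

/-- The right-hand side is Lipschitz only on bounded sets, but on each compact `[a, t]` both
solutions are continuous, hence stay in a common ball. -/
theorem quadratic_solution_unique (B : E →L[ℝ] E →L[ℝ] E) {a b : ℝ} {x y : ℝ → E}
    (hx : ∀ t ∈ Ico a b, HasDerivWithinAt x (B (x t) (x t)) (Ico a b) t)
    (hy : ∀ t ∈ Ico a b, HasDerivWithinAt y (B (y t) (y t)) (Ico a b) t)
    (h0 : x a = y a) : EqOn x y (Ico a b) := by
  intro t ht
  have hsub : Icc a t ⊆ Ico a b := fun s hs => ⟨hs.1, hs.2.trans_lt ht.2⟩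
  have hsub' : Ico a t ⊆ Ico a b := Ico_subset_Ico_right ht.2.le
  have hxc : ContinuousOn x (Icc a t) := fun s hs =>
    ((hx s (hsub hs)).continuousWithinAt).mono hsub
  have hyc : ContinuousOn y (Icc a t) := fun s hs =>
    ((hy s (hsub hs)).continuousWithinAt).mono hsub
  obtain ⟨C, hC⟩ := isCompact_Icc.exists_bound_of_continuousOn hxc
  obtain ⟨D, hD⟩ := isCompact_Icc.exists_bound_of_continuousOn hyc
  have hCR : ∀ s ∈ Ico a t, ‖x s‖ ≤ (max C D).toNNReal := fun s hs =>
    (hC s (Ico_subset_Icc_self hs)).trans ((le_max_left _ _).trans (Real.le_coe_toNNReal _))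
  have hDR : ∀ s ∈ Ico a t, ‖y s‖ ≤ (max C D).toNNReal := fun s hs =>
    (hD s (Ico_subset_Icc_self hs)).trans ((le_max_right _ _).trans (Real.le_coe_toNNReal _))
  exact ODE_solution_unique_of_mem_Icc_right (v := fun _ z => B z z)
    (s := fun _ => {z | ‖z‖ ≤ (max C D).toNNReal})
    (fun s _ => lipschitzOnWith_quadratic B _) hxc
    (fun s hs => hasDerivWithinAt_Ici_of_Ico (hsub' hs) (hx s (hsub' hs))) hCR hyc
    (fun s hs => hasDerivWithinAt_Ici_of_Ico (hsub' hs) (hy s (hsub' hs))) hDR h0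
    (right_mem_Icc.2 ht.1)

/-- A bounded solution of a quadratic differential equation can be continued. -/
theorem exists_quadratic_extension [CompleteSpace E] (B : E →L[ℝ] E →L[ℝ] E) {T M : ℝ}
    (hT : 0 < T) {x : ℝ → E}
    (hx : ∀ t ∈ Ico 0 T, HasDerivWithinAt x (B (x t) (x t)) (Ico 0 T) t)
    (hM : ∀ t ∈ Ico 0 T, ‖x t‖ ≤ M) :
    ∃ S > T, ∃ y : ℝ → E, y 0 = x 0 ∧
      ∀ t ∈ Ico 0 S, HasDerivWithinAt y (B (y t) (y t)) (Ico 0 S) t := by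
  obtain ⟨τ, hτ, H⟩ := exists_quadratic_solution B M
  -- Restarting less than `τ` before `T` makes the new piece reach beyond `T`. By uniqueness it
  -- agrees with `x` on `[t₀, T)`, so the glued curve coincides with `w` near every `t ≥ T`.
  set t₀ : ℝ := max 0 (T - τ / 2) with ht₀
  have h0 : 0 ≤ t₀ := le_max_left _ _
  have h1 : t₀ < T := max_lt hT (by linarith)
  have h2 : T < t₀ + τ := by linarith [le_max_right 0 (T - τ / 2)]
  obtain ⟨w, hw0, hw⟩ := H (x t₀) (hM t₀ ⟨h0, h1⟩) t₀
  have hsub : Ico t₀ T ⊆ Ico 0 T := Ico_subset_Ico_left h0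
  have hsub' : Ico t₀ T ⊆ Icc t₀ (t₀ + τ) := fun s hs => ⟨hs.1, by linarith [hs.2]⟩
  have heq : EqOn x w (Ico t₀ T) := quadratic_solution_unique B
    (fun t ht => (hx t (hsub ht)).mono hsub) (fun t ht => (hw t (hsub' ht)).mono hsub') hw0.symm
  classical
  set y : ℝ → E := fun t => if t < T then x t else w t with hy
  have hyx : ∀ t < T, y t = x t := fun t ht => if_pos ht
  have hyw : ∀ t, t₀ ≤ t → y t = w t := by
    intro t ht
    by_cases h : t < T
    · rw [hyx t h]; exact heq ⟨ht, h⟩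
    · exact if_neg h
  refine ⟨t₀ + τ, h2, y, hyx 0 hT, fun t ht => ?_⟩
  by_cases h : t < T
  · have hev : y =ᶠ[𝓝[Ico 0 (t₀ + τ)] t] x :=
      mem_nhdsWithin_of_mem_nhds (mem_of_superset (Iio_mem_nhds h) hyx)
    rw [hyx t h]
    refine HasDerivWithinAt.congr_of_eventuallyEq ?_ hev (hyx t h)
    refine (hx t ⟨ht.1, h⟩).mono_of_mem_nhdsWithin ?_
    filter_upwards [self_mem_nhdsWithin, mem_nhdsWithin_of_mem_nhds (Iio_mem_nhds h)] with s hs hs'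
    exact ⟨hs.1, hs'⟩
  · have htt : t₀ < t := h1.trans_le (not_lt.1 h)
    have hev : y =ᶠ[𝓝[Ico 0 (t₀ + τ)] t] w :=
      mem_nhdsWithin_of_mem_nhds (mem_of_superset (Ioi_mem_nhds htt) fun s hs => hyw s (le_of_lt hs))
    rw [hyw t htt.le]
    refine HasDerivWithinAt.congr_of_eventuallyEq ?_ hev (hyw t htt.le)
    exact ((hw t ⟨htt.le, ht.2.le⟩).hasDerivAt (Icc_mem_nhds htt ht.2)).hasDerivWithinAt

/-- Grönwall's inequality with a variable rate, qualitative form. -/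
theorem exists_bound_of_norm_deriv_le_mul {T : ℝ} {x x' : ℝ → E} {a : ℝ → ℝ}
    (hx : ∀ t ∈ Ico 0 T, HasDerivWithinAt x (x' t) (Ico 0 T) t)
    (hac : ContinuousOn a (Ico 0 T)) (ha0 : ∀ t ∈ Ico 0 T, 0 ≤ a t)
    (hai : IntegrableOn a (Ico 0 T))
    (hbd : ∀ t ∈ Ico 0 T, ‖x' t‖ ≤ a t * ‖x t‖) :
    ∃ M, ∀ t ∈ Ico 0 T, ‖x t‖ ≤ M := by
  set I : ℝ := ∫ s in Ico 0 T, a s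
  refine ⟨(‖x 0‖ + 1) * Real.exp (I + T), fun b hb => ?_⟩
  set A : ℝ → ℝ := fun t => ∫ s in (0 : ℝ)..t, a s with hA
  have hint : ∀ t ∈ Ico 0 T, IntervalIntegrable a volume 0 t := fun t ht =>
    (intervalIntegrable_iff_integrableOn_Icc_of_le ht.1).2
      (hai.mono_set fun s hs => ⟨hs.1, hs.2.trans_lt ht.2⟩)
  have hAI : ∀ t ∈ Ico 0 T, A t ≤ I := by
    intro t ht
    simp only [hA]
    rw [intervalIntegral.integral_of_le ht.1]
    refine setIntegral_mono_set hai ?_ ?_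
    · filter_upwards [self_mem_ae_restrict measurableSet_Ico] with s hs using ha0 s hs
    · exact LE.le.eventuallyLE fun s hs => ⟨hs.1.le, hs.2.trans_lt ht.2⟩
  have hAd : ∀ t ∈ Ico 0 T, HasDerivWithinAt A (a t) (Ici t) t := by
    intro t ht
    have hmem : Ico 0 T ∈ 𝓝[>] t :=
      mem_of_superset (Ioo_mem_nhdsGT ht.2) fun s hs => ⟨ht.1.trans hs.1.le, hs.2⟩
    refine intervalIntegral.integral_hasDerivWithinAt_right (hint t ht)
      ⟨Ico 0 T, hmem, hai.aestronglyMeasurable⟩ ?_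
    exact (hac t ht).mono_of_mem_nhdsWithin hmem
  have hsub : Icc 0 b ⊆ Ico 0 T := fun s hs => ⟨hs.1, hs.2.trans_lt hb.2⟩
  have hsub' : Ico 0 b ⊆ Ico 0 T := Ico_subset_Ico_right hb.2.le
  have hAc : ContinuousOn A (Icc 0 b) := by
    have := intervalIntegral.continuousOn_primitive_interval (a := 0) (b := b) (f := a)
      (μ := volume) (by rw [uIcc_of_le hb.1]; exact hai.mono_set hsub)
    rwa [uIcc_of_le hb.1] at this
  -- The comparison principle needs a strict inequality wherever `‖x‖` meets the barrier. The added
  -- `1` keeps the barrier positive, and the added `t` in the exponent raises its growth rate from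
  -- `a` to `a + 1`.
  have key := image_norm_le_of_norm_deriv_right_lt_deriv_boundary' (a := 0) (b := b)
    (f := x) (f' := x') (B := fun t => (‖x 0‖ + 1) * Real.exp (A t + t))
    (B' := fun t => (‖x 0‖ + 1) * (Real.exp (A t + t) * (a t + 1)))
    (fun s hs => (hx s (hsub hs)).continuousWithinAt.mono hsub)
    (fun s hs => hasDerivWithinAt_Ici_of_Ico (hsub' hs) (hx s (hsub' hs)))
    (by simp [hA]) (by fun_prop)
    (fun s hs => (((hAd s (hsub' hs)).add (hasDerivWithinAt_id s _)).exp).const_mul _)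
    (fun s hs hs' => by
      refine (hbd s (hsub' hs)).trans_lt ?_
      rw [hs']
      have : 0 < (‖x 0‖ + 1) * Real.exp (A s + s) := by positivity
      nlinarith)
    (right_mem_Icc.2 hb.1)
  refine key.trans ?_
  have h1 := hAI b hb
  have h2 := hb.2.le
  gcongr

end QuadraticODE

/-! ### Indefinite integrals and weak derivatives on the line -/

section Primitives

theorem _root_.MeasureTheory.LocallyIntegrable.intervalIntegrable_real {g : ℝ → ℝ}
    (hg : LocallyIntegrable g) (a b : ℝ) : IntervalIntegrable g volume a b :=
  intervalIntegrable_iff.2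
    ((hg.integrableOn_isCompact isCompact_uIcc).mono_set uIoc_subset_uIcc)

theorem integral_eq_interval {θ : ℝ → ℝ} {R : ℝ}
    (h : ∀ x, R ≤ |x| → θ x = 0) : ∫ x, θ x = ∫ x in (-R)..R, θ x := by
  refine (intervalIntegral.integral_eq_integral_of_support_subset fun x hx => ?_).symm
  have : |x| < R := by
    by_contra hc
    exact hx (h x (not_lt.1 hc))
  exact ⟨(abs_lt.1 this).1, (abs_lt.1 this).2.le⟩

theorem exists_zero_of_le_abs {φ : ℝ → ℝ} (hs : HasCompactSupport φ) :
    ∃ R > 0, ∀ x, R ≤ |x| → φ x = 0 := by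
  obtain ⟨R, hR, h⟩ := hs.exists_pos_le_norm
  exact ⟨R, hR, h⟩

/-- `F` is an indefinite integral of the locally integrable function `g`. -/
structure IsPrimitive (F g : ℝ → ℝ) : Prop where
  locallyIntegrable : LocallyIntegrable g
  sub_eq : ∀ a b, F b - F a = ∫ x in a..b, g x

namespace IsPrimitive

variable {F G f g h : ℝ → ℝ}

theorem eq_add (hF : IsPrimitive F g) (a b : ℝ) : F b = F a + ∫ x in a..b, g x := by
  linarith [hF.sub_eq a b]

theorem absolutelyContinuousOnInterval (hF : IsPrimitive F g) (a b : ℝ) :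
    AbsolutelyContinuousOnInterval F a b := by
  have h1 : AbsolutelyContinuousOnInterval (fun x => ∫ v in a..x, g v) a b :=
    (hF.locallyIntegrable.intervalIntegrable_real a b).absolutelyContinuousOnInterval_intervalIntegral
      left_mem_uIcc
  have h2 : AbsolutelyContinuousOnInterval (fun _ : ℝ => F a) a b :=
    (contDiff_const.contDiffOn (n := 1)).absolutelyContinuousOnInterval
  have h3 : F = (fun _ => F a) + fun x => ∫ v in a..x, g v := by
    ext x; exact hF.eq_add a x
  rw [h3]
  exact h2.add h1

theorem continuous (hF : IsPrimitive F g) : Continuous F := by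
  have h3 : F = fun x => F 0 + ∫ v in (0 : ℝ)..x, g v := by
    ext x; exact hF.eq_add 0 x
  rw [h3]
  exact continuous_const.add
    (intervalIntegral.continuous_primitive hF.locallyIntegrable.intervalIntegrable_real 0)

theorem ae_hasDerivAt (hF : IsPrimitive F g) : ∀ᵐ x, HasDerivAt F (g x) x := by
  filter_upwards [LocallyIntegrable.ae_hasDerivAt_integral hF.locallyIntegrable] with x hx
  have h3 : F = fun x => F 0 + ∫ v in (0 : ℝ)..x, g v := by
    ext x; exact hF.eq_add 0 x
  rw [h3]
  exact (hx 0).const_add _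

theorem of_contDiff (hF : ContDiff ℝ 1 F) : IsPrimitive F (deriv F) where
  locallyIntegrable := (hF.continuous_deriv le_rfl).locallyIntegrable
  sub_eq a b := (intervalIntegral.integral_deriv_eq_sub
    (fun x _ => (hF.differentiable one_ne_zero) x)
    ((hF.continuous_deriv le_rfl).intervalIntegrable a b)).symm

theorem mul (hF : IsPrimitive F f) (hG : IsPrimitive G g) :
    IsPrimitive (fun x => F x * G x) (fun x => f x * G x + F x * g x) where
  locallyIntegrable := by
    refine LocallyIntegrable.add ?_ ?_
    · have := hF.locallyIntegrable.smul_continuous hG.continuous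
      simpa [smul_eq_mul] using this
    · have := hG.locallyIntegrable.continuous_smul hF.continuous
      simpa [smul_eq_mul] using this
  sub_eq a b := by
    rw [← (hF.absolutelyContinuousOnInterval a b).integral_deriv_mul_eq_sub
      (hG.absolutelyContinuousOnInterval a b)]
    refine intervalIntegral.integral_congr_ae ?_
    filter_upwards [hF.ae_hasDerivAt, hG.ae_hasDerivAt] with x hx hx' _
    rw [hx.deriv, hx'.deriv]

/-- The product rule for `F φ` is integrated over an interval containing the support of `φ`; the
boundary terms vanish. -/
theorem isWeakDeriv (hF : IsPrimitive F g) : IsWeakDeriv F g := by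
  intro φ hφ hs
  obtain ⟨R, hR, h0⟩ := exists_zero_of_le_abs hs
  obtain ⟨R', hR', h0'⟩ := exists_zero_of_le_abs hs.deriv
  set r := max R R'
  have hφ1 : ContDiff ℝ 1 φ := hφ.of_le (by simp)
  have hm := hF.mul (of_contDiff hφ1)
  have hc : Continuous (deriv φ) := hφ1.continuous_deriv le_rfl
  have h1 := hm.sub_eq (-r) r
  have hr : |r| = r := abs_of_pos (lt_max_of_lt_left hR)
  simp only [h0 r (by rw [hr]; exact le_max_left _ _),
    h0 (-r) (by rw [abs_neg, hr]; exact le_max_left _ _), mul_zero, sub_zero] at h1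
  rw [intervalIntegral.integral_add] at h1
  · rw [integral_eq_interval (R := r) fun x hx => by rw [h0' x ((le_max_right _ _).trans hx), mul_zero],
      integral_eq_interval (R := r) fun x hx => by rw [h0 x ((le_max_left _ _).trans hx), mul_zero]]
    linarith
  · have := hF.locallyIntegrable.smul_continuous hφ.continuous
    exact LocallyIntegrable.intervalIntegrable_real (by simpa [smul_eq_mul] using this) _ _
  · exact (hF.continuous.mul hc).intervalIntegrable _ _

theorem of_locallyIntegrable (hg : LocallyIntegrable g) :
    IsPrimitive (fun x => ∫ v in (0 : ℝ)..x, g v) g where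
  locallyIntegrable := hg
  sub_eq _ _ := intervalIntegral.integral_interval_sub_left (hg.intervalIntegrable_real _ _)
    (hg.intervalIntegrable_real _ _)

theorem const_add (hF : IsPrimitive F g) (c : ℝ) : IsPrimitive (fun x => c + F x) g where
  locallyIntegrable := hF.locallyIntegrable
  sub_eq a b := by rw [← hF.sub_eq a b]; ring

end IsPrimitive

/-- The lemma of du Bois-Reymond. -/
theorem exists_ae_eq_const {h : ℝ → ℝ} (hh : LocallyIntegrable h)
    (H : ∀ φ : ℝ → ℝ, ContDiff ℝ ∞ φ → HasCompactSupport φ → ∫ x, h x * deriv φ x = 0) :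
    ∃ c : ℝ, ∀ᵐ x, h x = c := by
  have hint : ∀ {ψ : ℝ → ℝ}, Continuous ψ → HasCompactSupport ψ →
      Integrable fun x => h x * ψ x := fun hc hs => by
    simpa [smul_eq_mul, mul_comm] using hh.integrable_smul_left_of_hasCompactSupport hc hs
  let η₀ : ContDiffBump (0 : ℝ) := ⟨1, 2, one_pos, one_lt_two⟩
  set η : ℝ → ℝ := η₀.normed volume
  have hη : ContDiff ℝ ∞ η := η₀.contDiff_normed
  have hηs : HasCompactSupport η := η₀.hasCompactSupport_normed
  have hη1 : ∫ x, η x = 1 := η₀.integral_normed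
  refine ⟨∫ x, h x * η x, ae_eq_of_integral_contDiff_smul_eq hh
    (locallyIntegrable_const _) fun ψ hψ hs => ?_⟩
  -- Subtracting a multiple of the normalised bump makes the mean zero, so `θ` is the derivative of
  -- a compactly supported smooth function. The hypothesis applied to it gives `∫ h ψ = (∫ h η) (∫
  -- ψ)`.
  set θ : ℝ → ℝ := fun x => ψ x - (∫ y, ψ y) * η x with hθ
  have hθc : ContDiff ℝ ∞ θ := hψ.sub (contDiff_const.mul hη)
  obtain ⟨R, hR, h0⟩ := exists_zero_of_le_abs hs
  obtain ⟨R', hR', h0'⟩ := exists_zero_of_le_abs hηs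
  set r := max R R'
  have hr : 0 < r := lt_max_of_lt_left hR
  have hθ0 : ∀ x, r ≤ |x| → θ x = 0 := fun x hx => by
    simp [hθ, h0 x ((le_max_left _ _).trans hx), h0' x ((le_max_right _ _).trans hx)]
  have hθi : ∫ x, θ x = 0 := by
    rw [integral_sub (hψ.continuous.integrable_of_hasCompactSupport hs)
      ((hη.continuous.integrable_of_hasCompactSupport hηs).const_mul _), integral_const_mul, hη1]
    simp
  set φ : ℝ → ℝ := fun x => ∫ y in (-r)..x, θ y with hφ
  have hd : ∀ x, HasDerivAt φ (θ x) x := fun x =>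
    intervalIntegral.integral_hasDerivAt_right (hθc.continuous.intervalIntegrable _ _)
      (hθc.continuous.stronglyMeasurableAtFilter _ _) hθc.continuous.continuousAt
  have hdφ : deriv φ = θ := funext fun x => (hd x).deriv
  have hφc : ContDiff ℝ ∞ φ :=
    contDiff_infty_iff_deriv.2 ⟨fun x => (hd x).differentiableAt, hdφ ▸ hθc⟩
  have hφs : HasCompactSupport φ := by
    refine HasCompactSupport.intro (isCompact_Icc (a := -r) (b := r)) fun x hx => ?_
    rcases lt_or_ge x (-r) with hx1 | hx1
    · refine intervalIntegral.integral_zero_ae (ae_of_all _ fun y hy => hθ0 y ?_)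
      rw [uIoc_of_ge hx1.le] at hy
      exact le_abs.2 (Or.inr (by linarith [hy.2]))
    · have hx2 : r < x := by
        by_contra hc
        exact hx ⟨hx1, not_lt.1 hc⟩
      have h1 : ∫ y in r..x, θ y = 0 := by
        refine intervalIntegral.integral_zero_ae (ae_of_all _ fun y hy => hθ0 y ?_)
        rw [uIoc_of_le hx2.le] at hy
        exact le_abs.2 (Or.inl hy.1.le)
      simp only [hφ]
      rw [← intervalIntegral.integral_add_adjacent_intervals
        (hθc.continuous.intervalIntegrable (-r) r) (hθc.continuous.intervalIntegrable r x), h1,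
        add_zero, ← integral_eq_interval hθ0, hθi]
  have key := H φ hφc hφs
  rw [hdφ] at key
  have e : ∀ x, h x * θ x = h x * ψ x - (∫ y, ψ y) * (h x * η x) := fun x => by
    simp only [hθ]; ring
  simp only [e] at key
  rw [integral_sub (hint hψ.continuous hs) ((hint hη.continuous hηs).const_mul _),
    integral_const_mul] at key
  simp only [smul_eq_mul]
  rw [integral_mul_const]
  simp only [mul_comm (ψ _)]
  linarith

/-- The difference of `f` and a primitive of `g` has weak derivative zero, so it is constant by du
Bois-Reymond. -/
theorem exists_isPrimitive_of_isWeakDeriv {f g : ℝ → ℝ} (hf : LocallyIntegrable f)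
    (hg : LocallyIntegrable g) (hfg : IsWeakDeriv f g) :
    ∃ F, IsPrimitive F g ∧ f =ᵐ[volume] F := by
  have hG := IsPrimitive.of_locallyIntegrable hg
  set G : ℝ → ℝ := fun x => ∫ v in (0 : ℝ)..x, g v
  obtain ⟨c, hc⟩ := exists_ae_eq_const (hf.sub hG.continuous.locallyIntegrable) fun φ hφ hs => by
    have hi : ∀ {k : ℝ → ℝ}, LocallyIntegrable k → Integrable fun x => k x * deriv φ x :=
      fun hk => by
        simpa [smul_eq_mul, mul_comm] using
          hk.integrable_smul_left_of_hasCompactSupport (hφ.continuous_deriv (by simp)) hs.deriv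
    simp only [Pi.sub_apply, sub_mul]
    rw [integral_sub (hi hf) (hi hG.continuous.locallyIntegrable), hfg φ hφ hs,
      hG.isWeakDeriv φ hφ hs, sub_self]
  refine ⟨fun x => c + G x, hG.const_add c, ?_⟩
  filter_upwards [hc] with x hx
  simp only [Pi.sub_apply] at hx
  linarith

theorem IsWeakDeriv.congr {f f' g g' : ℝ → ℝ} (h : IsWeakDeriv f g) (hf : f =ᵐ[volume] f')
    (hg : g =ᵐ[volume] g') : IsWeakDeriv f' g' := by
  intro φ hφ hs
  have h1 : ∫ x, f x * deriv φ x = ∫ x, f' x * deriv φ x :=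
    integral_congr_ae (by filter_upwards [hf] with x hx; rw [hx])
  have h2 : ∫ x, g x * φ x = ∫ x, g' x * φ x :=
    integral_congr_ae (by filter_upwards [hg] with x hx; rw [hx])
  rw [← h1, ← h2]
  exact h φ hφ hs

theorem IsWeakDeriv.unique {f g g' : ℝ → ℝ} (h : IsWeakDeriv f g) (h' : IsWeakDeriv f g')
    (hg : LocallyIntegrable g) (hg' : LocallyIntegrable g') : g =ᵐ[volume] g' := by
  refine ae_eq_of_integral_contDiff_smul_eq hg hg' fun φ hφ hs => ?_
  simp only [smul_eq_mul, mul_comm (φ _)]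
  linarith [h φ hφ hs, h' φ hφ hs]

end Primitives

/-! ### Sobolev estimates, and the algebra and completeness of `H¹(ℝ)` -/

section Sobolev

theorem abs_intervalIntegral_le_sqrt_mul {g : ℝ → ℝ} (hg : MemLp g 2) {a b : ℝ} (hab : a ≤ b) :
    |∫ x in a..b, g x| ≤ √(b - a) * (eLpNorm g 2 volume).toReal := by
  have h1 : ‖∫ x in Ioc a b, g x‖ₑ ≤ eLpNorm g 2 volume * ENNReal.ofReal √(b - a) := by
    refine (enorm_integral_le_lintegral_enorm _).trans ?_
    rw [← eLpNorm_one_eq_lintegral_enorm]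
    refine (eLpNorm_le_eLpNorm_mul_rpow_measure_univ one_le_two
      hg.aestronglyMeasurable.restrict).trans ?_
    have e : (1 / (1 : ℝ≥0∞).toReal - 1 / (2 : ℝ≥0∞).toReal) = 1 / 2 := by norm_num
    rw [e, Measure.restrict_apply_univ, Real.volume_Ioc,
      ENNReal.ofReal_rpow_of_nonneg (sub_nonneg.2 hab) (by norm_num), ← Real.sqrt_eq_rpow]
    gcongr
    exact Measure.restrict_le_self
  have h2 := ENNReal.toReal_mono (ENNReal.mul_ne_top hg.eLpNorm_ne_top ENNReal.ofReal_ne_top) h1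
  rw [intervalIntegral.integral_of_le hab]
  rw [toReal_enorm, ENNReal.toReal_mul, ENNReal.toReal_ofReal (Real.sqrt_nonneg _),
    Real.norm_eq_abs] at h2
  linarith

/-- Cauchy–Schwarz on the interval between the points. This Hölder bound is what later makes the
singular integral converge. -/
theorem IsPrimitive.abs_sub_le {F g : ℝ → ℝ} (hF : IsPrimitive F g) (hg : MemLp g 2) (x y : ℝ) :
    |F x - F y| ≤ √|x - y| * (eLpNorm g 2 volume).toReal := by
  wlog h : y ≤ x generalizing x y
  · rw [abs_sub_comm, abs_sub_comm x]
    exact this y x (le_of_not_ge h)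
  rw [hF.sub_eq y x, abs_of_nonneg (sub_nonneg.2 h)]
  exact abs_intervalIntegral_le_sqrt_mul hg h

/-- On a unit interval the oscillation is at most `‖g‖₂`; averaging `|F x| ≤ |F z| + ‖g‖₂` over `z`
and applying Cauchy–Schwarz replaces the point value by `‖F‖₂`. -/
theorem IsPrimitive.abs_le {F g : ℝ → ℝ} (hF : IsPrimitive F g) (hF2 : MemLp F 2)
    (hg : MemLp g 2) (x : ℝ) :
    |F x| ≤ (eLpNorm F 2 volume).toReal + (eLpNorm g 2 volume).toReal := by
  have h1 : ∀ z ∈ Icc x (x + 1), |F x| ≤ |F z| + (eLpNorm g 2 volume).toReal := by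
    intro z hz
    have h2 := hF.abs_sub_le hg x z
    have h3 : √|x - z| ≤ 1 := Real.sqrt_le_one.2 (_root_.abs_le.2 ⟨by linarith [hz.2], by linarith [hz.1]⟩)
    have h4 : √|x - z| * (eLpNorm g 2 volume).toReal ≤ 1 * (eLpNorm g 2 volume).toReal := by
      gcongr
    have h5 : |F x| ≤ |F z| + |F x - F z| := by
      simpa using abs_add_le (F z) (F x - F z)
    linarith
  have h2 : ∫ _ in x..(x + 1), |F x| ≤
      ∫ z in x..(x + 1), (|F z| + (eLpNorm g 2 volume).toReal) :=
    intervalIntegral.integral_mono_on (by linarith) (by simp)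
      ((hF.continuous.abs.add continuous_const).intervalIntegrable _ _) h1
  rw [intervalIntegral.integral_add (hF.continuous.abs.intervalIntegrable _ _) (by simp)] at h2
  simp only [intervalIntegral.integral_const, add_sub_cancel_left, one_smul] at h2
  have h3 := abs_intervalIntegral_le_sqrt_mul hF2.norm (a := x) (b := x + 1) (by linarith)
  rw [eLpNorm_norm] at h3
  simp only [add_sub_cancel_left, Real.sqrt_one, one_mul, Real.norm_eq_abs] at h3
  linarith [le_abs_self (∫ z in x..(x + 1), |F z|)]

namespace H1

/-- The weak derivative of an element of `H¹(ℝ)`. -/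
noncomputable def wderiv (f : H1) : ℝ → ℝ := f.1.snd

theorem memLp (f : H1) : MemLp f 2 := Lp.memLp f.1.fst

theorem memLp_wderiv (f : H1) : MemLp f.wderiv 2 := Lp.memLp f.1.snd

theorem isWeakDeriv (f : H1) : IsWeakDeriv f f.wderiv := f.2

theorem exists_rep (f : H1) : ∃ F, IsPrimitive F f.wderiv ∧ f =ᵐ[volume] F :=
  exists_isPrimitive_of_isWeakDeriv (f.memLp.locallyIntegrable one_le_two)
    (f.memLp_wderiv.locallyIntegrable one_le_two) f.isWeakDeriv

/-- The continuous representative of an element of `H¹(ℝ)`. -/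
noncomputable def rep (f : H1) : ℝ → ℝ := f.exists_rep.choose

theorem isPrimitive_rep (f : H1) : IsPrimitive f.rep f.wderiv := f.exists_rep.choose_spec.1

theorem ae_eq_rep (f : H1) : f =ᵐ[volume] f.rep := f.exists_rep.choose_spec.2

theorem memLp_rep (f : H1) : MemLp f.rep 2 := f.memLp.ae_eq f.ae_eq_rep

theorem eLpNorm_toReal (f : H1) : (eLpNorm f 2 volume).toReal = ‖f.1.fst‖ := rfl

theorem eLpNorm_wderiv_toReal (f : H1) : (eLpNorm f.wderiv 2 volume).toReal = ‖f.1.snd‖ := rfl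

theorem norm_sq (f : H1) : ‖f‖ ^ 2 = ‖f.1.fst‖ ^ 2 + ‖f.1.snd‖ ^ 2 :=
  WithLp.prod_norm_sq_eq_of_L2 f.1

theorem norm_fst_le (f : H1) : ‖f.1.fst‖ ≤ ‖f‖ :=
  le_of_sq_le_sq (by rw [f.norm_sq]; linarith [sq_nonneg ‖f.1.snd‖]) (norm_nonneg _)

theorem norm_snd_le (f : H1) : ‖f.1.snd‖ ≤ ‖f‖ :=
  le_of_sq_le_sq (by rw [f.norm_sq]; linarith [sq_nonneg ‖f.1.fst‖]) (norm_nonneg _)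

theorem norm_le_add (f : H1) : ‖f‖ ≤ ‖f.1.fst‖ + ‖f.1.snd‖ :=
  le_of_sq_le_sq (by rw [f.norm_sq]; nlinarith [norm_nonneg f.1.fst, norm_nonneg f.1.snd])
    (by positivity)

theorem abs_rep_le (f : H1) (x : ℝ) : |f.rep x| ≤ 2 * ‖f‖ := by
  have h := f.isPrimitive_rep.abs_le f.memLp_rep f.memLp_wderiv x
  rw [← eLpNorm_congr_ae f.ae_eq_rep, eLpNorm_toReal, eLpNorm_wderiv_toReal] at h
  linarith [f.norm_fst_le, f.norm_snd_le]

/-- The supremum norm of an element of `H¹(ℝ)`. -/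
noncomputable def supNorm (f : H1) : ℝ := (eLpNorm f ⊤ volume).toReal

theorem memLp_top (f : H1) : MemLp f ⊤ :=
  memLp_top_of_bound f.memLp.aestronglyMeasurable (2 * ‖f‖) (by
    filter_upwards [f.ae_eq_rep] with x hx
    rw [hx]
    exact f.abs_rep_le x)

theorem supNorm_nonneg (f : H1) : 0 ≤ f.supNorm := ENNReal.toReal_nonneg

theorem supNorm_le (f : H1) : f.supNorm ≤ 2 * ‖f‖ := by
  refine ENNReal.toReal_le_of_le_ofReal (by positivity) ?_
  rw [eLpNorm_exponent_top]
  refine eLpNormEssSup_le_of_ae_bound ?_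
  filter_upwards [f.ae_eq_rep] with x hx
  rw [hx]
  exact f.abs_rep_le x

theorem ofReal_supNorm (f : H1) : ENNReal.ofReal f.supNorm = eLpNorm f ⊤ volume :=
  ENNReal.ofReal_toReal f.memLp_top.eLpNorm_ne_top

/-- The second component is determined by the first through uniqueness of weak derivatives, so
identities in `H1` can be checked on functions alone. -/
theorem ext_of_ae {f g : H1} (h : f =ᵐ[volume] g) : f = g := by
  have h1 : f.1.fst = g.1.fst := Lp.ext h
  have h2 : f.1.snd = g.1.snd := Lp.ext
    (IsWeakDeriv.unique f.isWeakDeriv (g.isWeakDeriv.congr h.symm EventuallyEq.rfl)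
      (f.memLp_wderiv.locallyIntegrable one_le_two) (g.memLp_wderiv.locallyIntegrable one_le_two))
  exact Subtype.ext (WithLp.ofLp_injective 2 (Prod.ext h1 h2))

theorem coe_add (f g : H1) : (f + g : H1) =ᵐ[volume] fun x => f x + g x :=
  Lp.coeFn_add f.1.fst g.1.fst

theorem coe_smul (c : ℝ) (f : H1) : (c • f : H1) =ᵐ[volume] fun x => c * f x :=
  Lp.coeFn_smul c f.1.fst

theorem coe_sub (f g : H1) : (f - g : H1) =ᵐ[volume] fun x => f x - g x :=
  Lp.coeFn_sub f.1.fst g.1.fst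

theorem abs_supNorm_sub_le (f g : H1) : |f.supNorm - g.supNorm| ≤ 2 * ‖f - g‖ := by
  have key : ∀ f g : H1, f.supNorm ≤ g.supNorm + (f - g).supNorm := by
    intro f g
    have h1 : f =ᵐ[volume] ((g : ℝ → ℝ) + (f - g : H1)) := by
      filter_upwards [coe_sub f g] with x hx
      simp only [Pi.add_apply] at hx ⊢
      rw [hx]; ring
    have h2 : eLpNorm f ⊤ volume ≤ eLpNorm g ⊤ volume + eLpNorm (f - g : H1) ⊤ volume := by
      rw [eLpNorm_congr_ae h1]
      exact eLpNorm_add_le g.memLp.aestronglyMeasurable (f - g).memLp.aestronglyMeasurable le_top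
    have h3 := ENNReal.toReal_mono
      (ENNReal.add_ne_top.2 ⟨g.memLp_top.eLpNorm_ne_top, (f - g).memLp_top.eLpNorm_ne_top⟩) h2
    rwa [ENNReal.toReal_add g.memLp_top.eLpNorm_ne_top (f - g).memLp_top.eLpNorm_ne_top] at h3
  have h1 := key f g
  have h2 := key g f
  have h3 := (f - g).supNorm_le
  have h4 := (g - f).supNorm_le
  rw [norm_sub_rev] at h4
  exact abs_le.2 ⟨by linarith, by linarith⟩

/-- Makes the Grönwall rate a continuous function of time along a solution. -/
theorem continuous_supNorm : Continuous supNorm := by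
  refine LipschitzWith.continuous (K := 2) (LipschitzWith.of_dist_le_mul fun f g => ?_)
  rw [Real.dist_eq, dist_eq_norm]
  exact abs_supNorm_sub_le f g

/-- The element of `H¹(ℝ)` with given value and weak derivative. -/
noncomputable def mk {f g : ℝ → ℝ} (hf : MemLp f 2) (hg : MemLp g 2) (h : IsWeakDeriv f g) : H1 :=
  ⟨WithLp.toLp 2 (hf.toLp f, hg.toLp g),
    h.congr hf.coeFn_toLp.symm hg.coeFn_toLp.symm⟩

theorem coe_mk {f g : ℝ → ℝ} (hf : MemLp f 2) (hg : MemLp g 2) (h : IsWeakDeriv f g) :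
    mk hf hg h =ᵐ[volume] f := hf.coeFn_toLp

theorem wderiv_mk {f g : ℝ → ℝ} (hf : MemLp f 2) (hg : MemLp g 2) (h : IsWeakDeriv f g) :
    (mk hf hg h).wderiv =ᵐ[volume] g := hg.coeFn_toLp

theorem norm_mk_le {f g : ℝ → ℝ} (hf : MemLp f 2) (hg : MemLp g 2) (h : IsWeakDeriv f g) :
    ‖mk hf hg h‖ ≤ (eLpNorm f 2 volume).toReal + (eLpNorm g 2 volume).toReal := by
  refine (norm_le_add _).trans (le_of_eq ?_)
  rw [← eLpNorm_toReal, ← eLpNorm_wderiv_toReal, eLpNorm_congr_ae (coe_mk hf hg h),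
    eLpNorm_congr_ae (wderiv_mk hf hg h)]

theorem memLp_mul (u : H1) {k : ℝ → ℝ} (hk : MemLp k 2) : MemLp (fun x => u x * k x) 2 :=
  MemLp.mul' hk u.memLp_top

theorem eLpNorm_mul_le (u : H1) {k : ℝ → ℝ} (hk : MemLp k 2) :
    (eLpNorm (fun x => u x * k x) 2 volume).toReal ≤
      u.supNorm * (eLpNorm k 2 volume).toReal := by
  rw [supNorm, ← ENNReal.toReal_mul]
  exact ENNReal.toReal_mono
    (ENNReal.mul_ne_top u.memLp_top.eLpNorm_ne_top hk.eLpNorm_ne_top)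
    (eLpNorm_smul_le_eLpNorm_top_mul_eLpNorm 2 hk.aestronglyMeasurable u)

theorem isWeakDeriv_mul (u w : H1) :
    IsWeakDeriv (fun x => u x * w x) (fun x => w x * u.wderiv x + u x * w.wderiv x) := by
  refine (u.isPrimitive_rep.mul w.isPrimitive_rep).isWeakDeriv.congr ?_ ?_ <;>
  · filter_upwards [u.ae_eq_rep, w.ae_eq_rep] with x hx hx'
    rw [hx, hx']
    try ring

/-- The product of two elements of `H¹(ℝ)`. -/
noncomputable def mul (u w : H1) : H1 :=
  mk (u.memLp_mul w.memLp) ((w.memLp_mul u.memLp_wderiv).add (u.memLp_mul w.memLp_wderiv))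
    (isWeakDeriv_mul u w)

theorem coe_mul (u w : H1) : mul u w =ᵐ[volume] fun x => u x * w x := coe_mk _ _ _

theorem wderiv_mul (u w : H1) :
    (mul u w).wderiv =ᵐ[volume] fun x => w x * u.wderiv x + u x * w.wderiv x := wderiv_mk _ _ _

/-- Leibniz' rule, with the undifferentiated factor always taken in the sup norm. Each term is
linear in an `H1` norm, which is what lets sup norms alone govern blow-up. -/
theorem norm_mul_le (u w : H1) :
    ‖mul u w‖ ≤ 2 * (u.supNorm * ‖w‖ + w.supNorm * ‖u‖) := by
  have h1 := norm_mk_le (u.memLp_mul w.memLp)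
    ((w.memLp_mul u.memLp_wderiv).add (u.memLp_mul w.memLp_wderiv)) (isWeakDeriv_mul u w)
  have h2 := u.eLpNorm_mul_le w.memLp
  have h3 := w.eLpNorm_mul_le u.memLp_wderiv
  have h4 := u.eLpNorm_mul_le w.memLp_wderiv
  have h5 := ENNReal.toReal_mono
    (ENNReal.add_ne_top.2 ⟨(w.memLp_mul u.memLp_wderiv).eLpNorm_ne_top,
      (u.memLp_mul w.memLp_wderiv).eLpNorm_ne_top⟩)
    (eLpNorm_add_le (w.memLp_mul u.memLp_wderiv).aestronglyMeasurable
      (u.memLp_mul w.memLp_wderiv).aestronglyMeasurable one_le_two)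
  rw [ENNReal.toReal_add (w.memLp_mul u.memLp_wderiv).eLpNorm_ne_top
      (u.memLp_mul w.memLp_wderiv).eLpNorm_ne_top] at h5
  rw [eLpNorm_toReal] at h2
  rw [eLpNorm_wderiv_toReal] at h3 h4
  have h6 := mul_le_mul_of_nonneg_left w.norm_fst_le u.supNorm_nonneg
  have h7 := mul_le_mul_of_nonneg_left u.norm_snd_le w.supNorm_nonneg
  have h8 := mul_le_mul_of_nonneg_left w.norm_snd_le u.supNorm_nonneg
  have h9 := mul_nonneg w.supNorm_nonneg (norm_nonneg u)
  have h10 : ‖mul u w‖ ≤ _ := h1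
  linarith!

theorem integrable_mul (u w : H1) : Integrable (mul u w : ℝ → ℝ) :=
  (MemLp.integrable_mul (p := 2) (q := 2) u.memLp w.memLp).congr (coe_mul u w).symm

theorem integrable_wderiv_mul (u w : H1) : Integrable (mul u w).wderiv :=
  ((MemLp.integrable_mul (p := 2) (q := 2) w.memLp u.memLp_wderiv).add
    (MemLp.integrable_mul (p := 2) (q := 2) u.memLp w.memLp_wderiv)).congr (wderiv_mul u w).symm

theorem inner_toLp {ψ : ℝ → ℝ} (hψ : MemLp ψ 2) (f : L2) :
    inner ℝ (hψ.toLp ψ) f = ∫ x, f x * ψ x := by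
  rw [L2.inner_def]
  refine integral_congr_ae ?_
  filter_upwards [hψ.coeFn_toLp] with x hx
  rw [hx]
  simp

/-- Each test function imposes an equation between `L²` inner products, hence a closed condition. -/
theorem isClosed_sobolevH1 : IsClosed (sobolevH1 : Set (WithLp 2 (L2 × L2))) := by
  have e : (sobolevH1 : Set (WithLp 2 (L2 × L2))) = ⋂ (φ : ℝ → ℝ) (_ : ContDiff ℝ ∞ φ)
      (_ : HasCompactSupport φ), {p | ∫ x, p.fst x * deriv φ x = -∫ x, p.snd x * φ x} := by
    ext p
    simp only [mem_iInter]
    rfl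
  rw [e]
  refine isClosed_iInter fun φ => isClosed_iInter fun hφ => isClosed_iInter fun hs => ?_
  have h1 : MemLp (deriv φ) 2 volume :=
    (hφ.continuous_deriv (by simp)).memLp_of_hasCompactSupport hs.deriv
  have h2 : MemLp φ 2 volume := hφ.continuous.memLp_of_hasCompactSupport hs
  simp only [← inner_toLp h1, ← inner_toLp h2]
  have c1 : Continuous fun p : WithLp 2 (L2 × L2) => p.fst := (WithLp.fstL 2 ℝ L2 L2).continuous
  have c2 : Continuous fun p : WithLp 2 (L2 × L2) => p.snd := (WithLp.sndL 2 ℝ L2 L2).continuous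
  exact isClosed_eq (continuous_const.inner c1) (continuous_const.inner c2).neg

instance : CompleteSpace H1 := isClosed_sobolevH1.completeSpace_coe

end H1

end Sobolev

/-! ### Convolution with bounded kernels -/

section Smoothing

/-- The convolution of `f` with the kernel `k`. -/
noncomputable def convKernel (k f : ℝ → ℝ) (x : ℝ) : ℝ := ∫ s, f s * k (x - s)

variable {k f g : ℝ → ℝ} {C : ℝ}

theorem integrable_mul_kernel (hf : Integrable f) (hk : Measurable k) (hb : ∀ x, |k x| ≤ C)
    (x : ℝ) : Integrable fun s => f s * k (x - s) :=
  hf.mul_bdd (c := C) (hk.comp (measurable_const.sub measurable_id)).aestronglyMeasurable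
    (ae_of_all _ fun s => hb (x - s))

theorem convKernel_eq_swap (x : ℝ) : convKernel k f x = ∫ z, f (x - z) * k z := by
  rw [convKernel, ← integral_sub_left_eq_self _ volume x]
  simp

theorem continuous_convKernel (hf : Integrable f) (hk : Continuous k) (hb : ∀ x, |k x| ≤ C) :
    Continuous (convKernel k f) := by
  have hbdd : BddAbove (range fun x => ‖k x‖) := ⟨C, by rintro _ ⟨x, rfl⟩; exact hb x⟩
  exact hbdd.continuous_convolution_right_of_integrable (ContinuousLinearMap.mul ℝ ℝ) hf hk

/-- Fubini moves the convolution onto the test function, whose translates are again test functions.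
The kernel is only bounded and is never differentiated. -/
theorem isWeakDeriv_convKernel (hf : Integrable f) (hg : Integrable g) (hfg : IsWeakDeriv f g)
    (hk : Continuous k) (hb : ∀ x, |k x| ≤ C) :
    IsWeakDeriv (convKernel k f) (convKernel k g) := by
  have key : ∀ {h ψ : ℝ → ℝ}, Integrable h → Integrable ψ →
      ∫ x, convKernel k h x * ψ x = ∫ z, k z * ∫ x, h x * ψ (x + z) := by
    intro h ψ hh hψ
    have h1 := (hψ.convolution_integrand (ContinuousLinearMap.mul ℝ ℝ) hh.comp_neg)
    have h2 : Integrable (fun p : ℝ × ℝ => h (p.1 - p.2) * k p.2 * ψ p.1)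
        (volume.prod volume) := by
      have h3 := (h1.mul_bdd (c := C) (g := fun p : ℝ × ℝ => k p.1) (by fun_prop)
        (ae_of_all _ fun p => hb p.1)).swap
      refine h3.congr (ae_of_all _ fun p => ?_)
      simp only [Function.comp, Prod.fst_swap, Prod.snd_swap, ContinuousLinearMap.mul_apply']
      rw [neg_sub]; ring
    calc ∫ x, convKernel k h x * ψ x = ∫ x, ∫ z, h (x - z) * k z * ψ x := by
          simp_rw [convKernel_eq_swap, integral_mul_const]
      _ = ∫ z, ∫ x, h (x - z) * k z * ψ x := integral_integral_swap h2
      _ = ∫ z, k z * ∫ x, h x * ψ (x + z) := by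
          refine integral_congr_ae (ae_of_all _ fun z => ?_)
          simp only
          rw [← integral_const_mul, ← integral_add_right_eq_self _ z]
          refine integral_congr_ae (ae_of_all _ fun x => ?_)
          simp only [add_sub_cancel_right]; ring
  intro φ hφ hs
  have hd : Continuous (deriv φ) := hφ.continuous_deriv (by simp)
  rw [key hf (hd.integrable_of_hasCompactSupport hs.deriv),
    key hg (hφ.continuous.integrable_of_hasCompactSupport hs), ← integral_neg]
  refine integral_congr_ae (ae_of_all _ fun z => ?_)
  have hφz : ContDiff ℝ ∞ fun x => φ (x + z) := hφ.comp (contDiff_id.add contDiff_const)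
  have hsz : HasCompactSupport fun x => φ (x + z) :=
    hs.comp_homeomorph (Homeomorph.addRight z)
  have h4 := hfg _ hφz hsz
  simp only [deriv_comp_add_const] at h4
  simp only [h4, mul_neg]

theorem integrable_kernel_mul_kernel (hk2 : MemLp k 2) (s t : ℝ) :
    Integrable fun x => k (x - s) * k (x - t) := by
  have h : ∀ s, MemLp (fun x => k (x - s)) 2 volume := fun s =>
    hk2.comp_measurePreserving (measurePreserving_sub_right volume s)
  exact MemLp.integrable_mul (p := 2) (q := 2) (h s) (h t)

theorem convKernel_sq (x : ℝ) :
    convKernel k f x ^ 2 = ∫ p : ℝ × ℝ, f p.1 * f p.2 * (k (x - p.1) * k (x - p.2)) := by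
  rw [sq, convKernel, ← integral_prod_mul]
  refine integral_congr_ae (ae_of_all _ fun p => ?_)
  simp only; ring

/-- By the inequality of means the integral of `|k (x - s) k (x - t)|` over `x` is at most `∫ k²`,
uniformly in `s` and `t`, so `f ⊗ f` controls the rest. -/
theorem integrable_convKernel_integrand (hf : Integrable f) (hk : Continuous k)
    (hk2 : MemLp k 2) :
    Integrable (fun q : ℝ × (ℝ × ℝ) => f q.2.1 * f q.2.2 * (k (q.1 - q.2.1) * k (q.1 - q.2.2)))
      (volume.prod (volume.prod volume)) := by
  have hff : Integrable (fun p : ℝ × ℝ => f p.1 * f p.2) (volume.prod volume) := hf.mul_prod hf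
  have hm : AEStronglyMeasurable
      (fun q : ℝ × (ℝ × ℝ) => f q.2.1 * f q.2.2 * (k (q.1 - q.2.1) * k (q.1 - q.2.2)))
      (volume.prod (volume.prod volume)) :=
    (hff.aestronglyMeasurable.comp_snd).mul (by fun_prop)
  rw [integrable_prod_iff' hm]
  refine ⟨ae_of_all _ fun p =>
    (integrable_kernel_mul_kernel hk2 p.1 p.2).const_mul (f p.1 * f p.2), ?_⟩
  have hksq : Integrable fun x => k x ^ 2 := hk2.integrable_sq
  refine Integrable.mono' (hff.norm.mul_const (∫ x, k x ^ 2))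
    hm.norm.prod_swap.integral_prod_right' (ae_of_all _ fun p => ?_)
  rw [Real.norm_of_nonneg (integral_nonneg fun x => norm_nonneg _)]
  simp only [norm_mul (_ * _) (_ * _)]
  rw [integral_const_mul]
  refine mul_le_mul_of_nonneg_left ?_ (norm_nonneg _)
  have h1 : ∀ s, ∫ x, k (x - s) ^ 2 = ∫ x, k x ^ 2 := fun s =>
    integral_sub_right_eq_self (fun x => k x ^ 2) s
  have h2 : ∀ s, Integrable fun x => k (x - s) ^ 2 := fun s => hksq.comp_sub_right s
  calc ∫ x, ‖k (x - p.1) * k (x - p.2)‖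
      ≤ ∫ x, (1 / 2 * k (x - p.1) ^ 2 + 1 / 2 * k (x - p.2) ^ 2) := by
        refine integral_mono (integrable_kernel_mul_kernel hk2 _ _).norm
          (((h2 _).const_mul _).add ((h2 _).const_mul _)) fun x => ?_
        simp only [Real.norm_eq_abs]
        exact abs_le.2 ⟨by nlinarith [sq_nonneg (k (x - p.1) + k (x - p.2))],
          by nlinarith [sq_nonneg (k (x - p.1) - k (x - p.2))]⟩
    _ = ∫ x, k x ^ 2 := by
        rw [integral_add ((h2 _).const_mul _) ((h2 _).const_mul _), integral_const_mul,
          integral_const_mul, h1, h1]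
        ring

theorem integrable_convKernel_sq (hf : Integrable f) (hk : Continuous k) (hk2 : MemLp k 2) :
    Integrable fun x => convKernel k f x ^ 2 := by
  simp_rw [convKernel_sq]
  exact (integrable_convKernel_integrand hf hk hk2).integral_prod_left

/-- The kernel enters the `L²` norm of the convolution only through its autocorrelation, so kernels
with equal autocorrelations give equal norms. -/
theorem integral_convKernel_sq (hf : Integrable f) (hk : Continuous k) (hk2 : MemLp k 2) :
    ∫ x, convKernel k f x ^ 2 =
      ∫ p : ℝ × ℝ, f p.1 * f p.2 * ∫ x, k (x - p.1) * k (x - p.2) := by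
  simp_rw [convKernel_sq]
  refine (integral_integral_swap (integrable_convKernel_integrand hf hk hk2)).trans ?_
  simp_rw [integral_const_mul]

/-- Convolution with a nonnegative kernel of mass `m` has norm at most `m` on `L²`. -/
theorem integral_convKernel_sq_le (hf : Integrable f) (hf2 : MemLp f 2) (hk : Continuous k)
    (hb : ∀ x, |k x| ≤ C) (hk0 : ∀ x, 0 ≤ k x) (hki : Integrable k) (hk2 : MemLp k 2) {m : ℝ}
    (hm : 0 < m) (hkm : ∫ x, k x = m) :
    ∫ x, convKernel k f x ^ 2 ≤ m ^ 2 * ∫ x, f x ^ 2 := by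
  have hfsq : Integrable fun x => f x ^ 2 := hf2.integrable_sq
  have h1 : ∀ x, convKernel k f x ^ 2 ≤ m * convKernel k (fun s => f s ^ 2) x := by
    intro x
    -- `c` is the mean of `f` for the weight `k (x - ·)`; expanding the weighted integral of `(f -
    -- c)² ≥ 0` gives Jensen's inequality.
    set c := convKernel k f x / m with hc
    have i1 := integrable_mul_kernel hfsq hk.measurable hb x
    have i2 := integrable_mul_kernel hf hk.measurable hb x
    have i3 : Integrable fun s => k (x - s) := hki.comp_sub_left x
    have h2 : 0 ≤ ∫ s, (f s ^ 2 * k (x - s) - 2 * c * (f s * k (x - s)) + c ^ 2 * k (x - s)) := by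
      refine integral_nonneg fun s => ?_
      have := mul_nonneg (sq_nonneg (f s - c)) (hk0 (x - s))
      simp only [Pi.zero_apply]
      nlinarith
    rw [integral_add (f := fun s => f s ^ 2 * k (x - s) - 2 * c * (f s * k (x - s)))
      (i1.sub (i2.const_mul (2 * c))) (i3.const_mul (c ^ 2)), integral_sub i1 (i2.const_mul _),
      integral_const_mul, integral_const_mul, integral_sub_left_eq_self k volume x, hkm] at h2
    change 0 ≤ convKernel k (fun s => f s ^ 2) x - 2 * c * convKernel k f x + c ^ 2 * m at h2
    have h3 : convKernel k f x = c * m := by rw [hc]; field_simp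
    rw [h3] at h2 ⊢
    nlinarith
  have h4 : Integrable (convKernel k fun s => f s ^ 2) :=
    hfsq.integrable_convolution (ContinuousLinearMap.mul ℝ ℝ) hki
  have h5 : ∫ x, convKernel k (fun s => f s ^ 2) x = (∫ x, f x ^ 2) * m := by
    rw [← hkm]
    exact integral_convolution (ContinuousLinearMap.mul ℝ ℝ) hfsq hki
  calc ∫ x, convKernel k f x ^ 2 ≤ ∫ x, m * convKernel k (fun s => f s ^ 2) x :=
        integral_mono (integrable_convKernel_sq hf hk hk2) (h4.const_mul _) h1
    _ = m ^ 2 * ∫ x, f x ^ 2 := by rw [integral_const_mul, h5]; ring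

end Smoothing

/-! ### Poisson and conjugate Poisson kernels; the `L²` bound -/

section PoissonKernel

/-- The conjugate Poisson kernel, without its factor `1/π`. -/
noncomputable def conjPoisson (δ x : ℝ) : ℝ := x / (x ^ 2 + δ ^ 2)

/-- The Poisson kernel, without its factor `1/π`. -/
noncomputable def poisson (δ x : ℝ) : ℝ := δ / (x ^ 2 + δ ^ 2)

variable {δ : ℝ}

theorem continuous_conjPoisson (hδ : 0 < δ) : Continuous (conjPoisson δ) :=
  continuous_id.div (by fun_prop) fun x => by positivity

theorem continuous_poisson (hδ : 0 < δ) : Continuous (poisson δ) :=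
  continuous_const.div (by fun_prop) fun x => by positivity

theorem abs_conjPoisson_le (hδ : 0 < δ) (x : ℝ) : |conjPoisson δ x| ≤ 1 / δ := by
  rw [conjPoisson, abs_div, abs_of_pos (by positivity : 0 < x ^ 2 + δ ^ 2),
    div_le_div_iff₀ (by positivity) hδ, ← sq_abs x]
  nlinarith [sq_nonneg (|x| - δ), abs_nonneg x]

theorem abs_conjPoisson_le_inv (hδ : 0 < δ) (x : ℝ) : |conjPoisson δ x| ≤ |x|⁻¹ := by
  rcases eq_or_ne x 0 with rfl | hx
  · simp [conjPoisson]
  rw [conjPoisson, abs_div, abs_of_pos (by positivity : 0 < x ^ 2 + δ ^ 2), ← one_div,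
    div_le_div_iff₀ (by positivity) (abs_pos.2 hx), ← sq_abs x]
  nlinarith [sq_nonneg δ]

theorem poisson_nonneg (hδ : 0 < δ) (x : ℝ) : 0 ≤ poisson δ x := by
  unfold poisson; positivity

theorem abs_poisson_le (hδ : 0 < δ) (x : ℝ) : |poisson δ x| ≤ 1 / δ := by
  rw [abs_of_nonneg (poisson_nonneg hδ x), poisson, div_le_div_iff₀ (by positivity) hδ]
  nlinarith [sq_nonneg x]

theorem poisson_eq (hδ : 0 < δ) (x : ℝ) : poisson δ x = δ⁻¹ * (1 + (x / δ) ^ 2)⁻¹ := by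
  unfold poisson; field_simp; ring

theorem integrable_poisson (hδ : 0 < δ) : Integrable (poisson δ) := by
  simp_rw [funext (poisson_eq hδ)]
  exact (integrable_inv_one_add_sq.comp_div hδ.ne').const_mul _

theorem integral_poisson (hδ : 0 < δ) : ∫ x, poisson δ x = Real.pi := by
  simp_rw [poisson_eq hδ]
  rw [integral_const_mul, Measure.integral_comp_div (fun x : ℝ => (1 + x ^ 2)⁻¹) δ,
    integral_univ_inv_one_add_sq, abs_of_pos hδ, smul_eq_mul, inv_mul_cancel_left₀ hδ.ne']

theorem conjPoisson_sq_add_poisson_sq (hδ : 0 < δ) (x : ℝ) :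
    conjPoisson δ x ^ 2 + poisson δ x ^ 2 = δ⁻¹ * poisson δ x := by
  unfold conjPoisson poisson; field_simp

theorem memLp_conjPoisson (hδ : 0 < δ) : MemLp (conjPoisson δ) 2 := by
  rw [memLp_two_iff_integrable_sq (continuous_conjPoisson hδ).aestronglyMeasurable]
  refine ((integrable_poisson hδ).const_mul δ⁻¹).mono'
    ((continuous_conjPoisson hδ).pow 2).aestronglyMeasurable (ae_of_all _ fun x => ?_)
  rw [Real.norm_of_nonneg (sq_nonneg _)]
  nlinarith [conjPoisson_sq_add_poisson_sq hδ x, sq_nonneg (poisson δ x)]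

theorem memLp_poisson (hδ : 0 < δ) : MemLp (poisson δ) 2 := by
  rw [memLp_two_iff_integrable_sq (continuous_poisson hδ).aestronglyMeasurable]
  refine ((integrable_poisson hδ).const_mul δ⁻¹).mono'
    ((continuous_poisson hδ).pow 2).aestronglyMeasurable (ae_of_all _ fun x => ?_)
  rw [Real.norm_of_nonneg (sq_nonneg _)]
  nlinarith [conjPoisson_sq_add_poisson_sq hδ x, sq_nonneg (conjPoisson δ x)]

theorem tendsto_conjPoisson_zero (hδ : 0 < δ) :
    Tendsto (conjPoisson δ) (cocompact ℝ) (𝓝 0) := by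
  have h : Tendsto (fun x : ℝ => |x|⁻¹) (cocompact ℝ) (𝓝 0) :=
    (tendsto_norm_cocompact_atTop (E := ℝ)).inv_tendsto_atTop
  exact squeeze_zero_norm (fun x => abs_conjPoisson_le_inv hδ x) h

theorem tendsto_poisson_zero (hδ : 0 < δ) :
    Tendsto (poisson δ) (cocompact ℝ) (𝓝 0) := by
  have h : Tendsto (fun x : ℝ => |x|⁻¹) (cocompact ℝ) (𝓝 0) :=
    (tendsto_norm_cocompact_atTop (E := ℝ)).inv_tendsto_atTop
  refine squeeze_zero_norm' ?_ h
  filter_upwards [(isCompact_singleton (x := (0 : ℝ))).compl_mem_cocompact] with x hx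
  have hx' : x ≠ 0 := hx
  rw [Real.norm_of_nonneg (poisson_nonneg hδ x), poisson, ← one_div,
    div_le_div_iff₀ (by positivity) (abs_pos.2 hx'), ← sq_abs x]
  nlinarith [sq_nonneg (|x| - δ), abs_nonneg x]

theorem integral_eq_zero_of_hasDerivAt {F F' : ℝ → ℝ} (h : ∀ x, HasDerivAt F (F' x) x)
    (hi : Integrable F') (ht : Tendsto F (cocompact ℝ) (𝓝 0)) : ∫ x, F' x = 0 := by
  rw [cocompact_eq_atBot_atTop, tendsto_sup] at ht
  rw [integral_of_hasDerivAt_of_tendsto h hi ht.1 ht.2, sub_zero]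

theorem tendsto_sub_const_cocompact (s : ℝ) :
    Tendsto (fun x : ℝ => x - s) (cocompact ℝ) (cocompact ℝ) :=
  (Homeomorph.subRight s).isClosedEmbedding.tendsto_cocompact

/-- The kernels satisfy `∫ Q(x - s) Q(x - t) dx = ∫ P(x - s) P(x - t) dx`. -/
theorem integral_conjPoisson_mul (hδ : 0 < δ) (s t : ℝ) :
    ∫ x, conjPoisson δ (x - s) * conjPoisson δ (x - t) =
      ∫ x, poisson δ (x - s) * poisson δ (x - t) := by
  have iQ := integrable_kernel_mul_kernel (memLp_conjPoisson hδ) s t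
  have iP := integrable_kernel_mul_kernel (memLp_poisson hδ) s t
  rw [← sub_eq_zero, ← integral_sub iQ iP]
  have hpos : ∀ r x : ℝ, 0 < (x - r) ^ 2 + δ ^ 2 := fun r x => by positivity
  -- With `Q - iP = 1 / (x + iδ)`, the integrand is the real part of `1 / ((x - s + iδ) (x - t +
  -- iδ))`. Partial fractions turn it into `(Q (x - s) - Q (x - t)) / (s - t)`, which has a
  -- logarithmic antiderivative; for `s = t` it degenerates to `-Q'`. Both antiderivatives vanish at
  -- infinity.
  rcases eq_or_ne s t with rfl | hst
  · refine integral_eq_zero_of_hasDerivAt (F := fun x => -conjPoisson δ (x - s)) (fun x => ?_)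
      (iQ.sub iP) ?_
    · have h1 : HasDerivAt (fun x : ℝ => x - s) 1 x := (hasDerivAt_id x).sub_const s
      have h2 := (h1.div ((h1.pow 2).add_const (δ ^ 2)) (hpos s x).ne').neg
      refine h2.congr_deriv ?_
      have := (hpos s x).ne'
      simp only [conjPoisson, poisson, Pi.pow_apply]
      field_simp
      ring
    · simpa using ((tendsto_conjPoisson_zero hδ).comp (tendsto_sub_const_cocompact s)).neg
  · have hne : s - t ≠ 0 := sub_ne_zero.2 hst
    have hd : ∀ r x : ℝ, HasDerivAt (fun x => Real.log ((x - r) ^ 2 + δ ^ 2))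
        (2 * conjPoisson δ (x - r)) x := by
      intro r x
      have h1 : HasDerivAt (fun x : ℝ => x - r) 1 x := (hasDerivAt_id x).sub_const r
      refine (((h1.pow 2).add_const (δ ^ 2)).log (hpos r x).ne').congr_deriv ?_
      have := (hpos r x).ne'
      simp only [conjPoisson, Pi.pow_apply]
      field_simp
      ring
    refine integral_eq_zero_of_hasDerivAt (F := fun x => (2 * (s - t))⁻¹ *
      (Real.log ((x - s) ^ 2 + δ ^ 2) - Real.log ((x - t) ^ 2 + δ ^ 2))) (fun x => ?_)
      (iQ.sub iP) ?_
    · refine (((hd s x).sub (hd t x)).const_mul _).congr_deriv ?_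
      have h1 := (hpos s x).ne'
      have h2 := (hpos t x).ne'
      simp only [conjPoisson, poisson]
      field_simp
      ring
    · have h1 : Tendsto (fun x => ((x - s) ^ 2 + δ ^ 2) / ((x - t) ^ 2 + δ ^ 2))
          (cocompact ℝ) (𝓝 1) := by
        have hq := (tendsto_conjPoisson_zero hδ).comp (tendsto_sub_const_cocompact t)
        have hp := (tendsto_poisson_zero hδ).comp (tendsto_sub_const_cocompact t)
        have h3 := ((hq.const_mul (2 * (t - s))).add (hp.const_mul ((t - s) ^ 2 / δ))).const_add 1
        simp only [mul_zero, add_zero] at h3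
        refine h3.congr fun x => ?_
        have := (hpos t x).ne'
        simp only [Function.comp, conjPoisson, poisson]
        field_simp
        ring
      have h4 := ((Real.continuousAt_log one_ne_zero).tendsto.comp h1).const_mul (2 * (s - t))⁻¹
      rw [Real.log_one, mul_zero] at h4
      refine h4.congr fun x => ?_
      simp only [Function.comp]
      rw [Real.log_div (hpos s x).ne' (hpos t x).ne']

variable {f : ℝ → ℝ}

/-- Equality of autocorrelations replaces the signed, non-integrable kernel by the Poisson kernel,
which is nonnegative of mass `π`. -/
theorem integral_conjPoisson_sq_le (hδ : 0 < δ) (hf : Integrable f) (hf2 : MemLp f 2) :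
    ∫ x, convKernel (conjPoisson δ) f x ^ 2 ≤ Real.pi ^ 2 * ∫ x, f x ^ 2 := by
  rw [integral_convKernel_sq hf (continuous_conjPoisson hδ) (memLp_conjPoisson hδ)]
  simp_rw [integral_conjPoisson_mul hδ]
  rw [← integral_convKernel_sq hf (continuous_poisson hδ) (memLp_poisson hδ)]
  exact integral_convKernel_sq_le hf hf2 (continuous_poisson hδ) (abs_poisson_le hδ)
    (poisson_nonneg hδ) (integrable_poisson hδ) (memLp_poisson hδ) Real.pi_pos
    (integral_poisson hδ)

end PoissonKernel

/-! ### Pointwise convergence of the singular integral -/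

section PrincipalValue

theorem HasHilbertTransformAt.congr {f g : ℝ → ℝ} {x l : ℝ} (h : HasHilbertTransformAt f x l)
    (hfg : f =ᵐ[volume] g) : HasHilbertTransformAt g x l := by
  have e : (fun y => f y / (x - y)) =ᵐ[volume] fun y => g y / (x - y) := by
    filter_upwards [hfg] with y hy
    rw [hy]
  refine ⟨fun ε hε => (h.1 ε hε).congr (ae_restrict_of_ae e), h.2.congr fun ε => ?_⟩
  rw [integral_congr_ae (ae_restrict_of_ae e)]

theorem HasHilbertTransformAt.unique {f : ℝ → ℝ} {x l l' : ℝ} (h : HasHilbertTransformAt f x l)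
    (h' : HasHilbertTransformAt f x l') : l = l' :=
  tendsto_nhds_unique h.2 h'.2

theorem HasHilbertTransformAt.add {f g : ℝ → ℝ} {x l m : ℝ} (hf : HasHilbertTransformAt f x l)
    (hg : HasHilbertTransformAt g x m) : HasHilbertTransformAt (fun y => f y + g y) x (l + m) := by
  refine ⟨fun ε hε => ?_, (hf.2.add hg.2).congr' ?_⟩
  · simp only [add_div]
    exact (hf.1 ε hε).add (hg.1 ε hε)
  · filter_upwards [self_mem_nhdsWithin] with ε hε
    simp only [add_div]
    rw [integral_add (hf.1 ε hε) (hg.1 ε hε), mul_add]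

theorem HasHilbertTransformAt.const_mul {f : ℝ → ℝ} {x l : ℝ} (c : ℝ)
    (hf : HasHilbertTransformAt f x l) : HasHilbertTransformAt (fun y => c * f y) x (c * l) := by
  refine ⟨fun ε hε => ?_, (hf.2.const_mul c).congr fun ε => ?_⟩
  · simp only [mul_div_assoc]
    exact (hf.1 ε hε).const_mul c
  · simp only [mul_div_assoc]
    rw [integral_const_mul]
    ring

/-- The symmetrised form of `π` times the Hilbert transform. -/
noncomputable def symmHilbert (f : ℝ → ℝ) (x : ℝ) : ℝ :=
  ∫ t in Ioi 0, (f (x - t) - f (x + t)) * t⁻¹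

/-- Folding an odd kernel onto the half-line produces differences of `f`, whose smallness near `t =
0` compensates the singularity. -/
theorem convKernel_eq_integral_Ioi {f k : ℝ → ℝ} {C : ℝ} (hf : Integrable f) (hk : Measurable k)
    (hb : ∀ x, |k x| ≤ C) (hodd : ∀ x, k (-x) = -k x) (x : ℝ) :
    convKernel k f x = ∫ t in Ioi 0, (f (x - t) - f (x + t)) * k t := by
  have i1 : Integrable fun z => f (x - z) * k z := by
    simpa using (integrable_mul_kernel hf hk hb x).comp_sub_left x
  have i2 : Integrable fun z => f (x + z) * k z := by
    refine i1.comp_neg.neg.congr (ae_of_all _ fun z => ?_)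
    simp [hodd]
  rw [convKernel_eq_swap, ← integral_add_compl (measurableSet_Ioi (a := (0 : ℝ))) i1, compl_Ioi,
    ← neg_zero, ← integral_comp_neg_Ioi, neg_zero]
  simp only [sub_neg_eq_add, hodd, mul_neg, sub_mul]
  rw [integral_neg, integral_sub i1.integrableOn i2.integrableOn, sub_eq_add_neg]

variable {F : ℝ → ℝ} {A : ℝ}

/-- An integrable majorant of the symmetrised singular integral, uniform in the base point. -/
theorem exists_majorant (hF : Integrable F) (hA : ∀ x y, |F x - F y| ≤ √|x - y| * A) :
    ∃ B : ℝ → ℝ → ℝ, ∃ K : ℝ, (∀ x, IntegrableOn (B x) (Ioi 0)) ∧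
      (∀ x, ∫ t in Ioi 0, B x t ≤ K) ∧
      ∀ x, ∀ t ∈ Ioi (0 : ℝ), |F (x - t) - F (x + t)| * t⁻¹ ≤ B x t := by
  have hA0 : 0 ≤ A := by simpa using (abs_nonneg _).trans (hA 1 0)
  -- For `t ≤ 1` the Hölder bound gives `√(2t) A / t ≤ 2 A t^(-1/2)`; for `t > 1` the factor `t⁻¹`
  -- is at most 1 and the translates of `|F|` suffice. Their integrals do not depend on `x`, hence
  -- neither does `K`.
  set b : ℝ → ℝ := (Ioc (0 : ℝ) 1).indicator fun t => 2 * A * t ^ (-(1 / 2) : ℝ) with hb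
  have ib : Integrable b := by
    rw [hb, integrable_indicator_iff measurableSet_Ioc]
    have h := intervalIntegral.intervalIntegrable_rpow' (a := 0) (b := 1)
      (r := -(1 / 2)) (by norm_num)
    exact ((intervalIntegrable_iff_integrableOn_Ioc_of_le zero_le_one).1 h).const_mul _
  have hb0 : ∀ t, 0 ≤ b t := fun t => indicator_nonneg (fun t ht => by
    have := ht.1.le
    positivity) t
  have i1 : ∀ x, Integrable fun t => |F (x - t)| := fun x => (hF.comp_sub_left x).abs
  have i2 : ∀ x, Integrable fun t => |F (x + t)| := fun x => (hF.comp_add_left x).abs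
  have i3 : ∀ x, Integrable fun t => b t + (|F (x - t)| + |F (x + t)|) :=
    fun x => ib.add ((i1 x).add (i2 x))
  refine ⟨fun x t => b t + (|F (x - t)| + |F (x + t)|),
    (∫ t, b t) + ((∫ t, |F t|) + ∫ t, |F t|), fun x => (i3 x).integrableOn, fun x => ?_,
    fun x t ht => ?_⟩
  · refine (setIntegral_le_integral (i3 x) (ae_of_all _ fun t => ?_)).trans (le_of_eq ?_)
    · have := hb0 t
      simp only [Pi.zero_apply]
      positivity
    · rw [integral_add (g := fun t => |F (x - t)| + |F (x + t)|) ib ((i1 x).add (i2 x)),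
        integral_add (i1 x) (i2 x),
        integral_sub_left_eq_self (fun t => |F t|) volume x,
        integral_add_left_eq_self (fun t => |F t|) x]
  · have ht0 : (0 : ℝ) < t := ht
    by_cases h1 : t ≤ 1
    · have h2 : b t = 2 * A * t ^ (-(1 / 2) : ℝ) :=
        indicator_of_mem (s := Ioc (0 : ℝ) 1) ⟨ht, h1⟩ _
      have h3 : |F (x - t) - F (x + t)| ≤ √(2 * t) * A := by
        refine (hA _ _).trans (le_of_eq ?_)
        congr 2
        rw [show x - t - (x + t) = -(2 * t) by ring, abs_neg, abs_of_pos (by positivity)]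
      have h4 : √(2 * t) ≤ 2 * √t := by
        rw [Real.sqrt_mul zero_le_two]
        have : √2 ≤ 2 := by
          rw [Real.sqrt_le_left zero_le_two]; norm_num
        gcongr
      have h5 : t ^ (-(1 / 2) : ℝ) = √t * t⁻¹ := by
        rw [Real.rpow_neg ht0.le, ← Real.sqrt_eq_rpow]
        have hs : √t ≠ 0 := (Real.sqrt_pos.2 ht0).ne'
        field_simp
        exact (Real.sq_sqrt ht0.le).symm
      have h6 : |F (x - t) - F (x + t)| * t⁻¹ ≤ 2 * √t * A * t⁻¹ := by
        have : √(2 * t) * A ≤ 2 * √t * A := by gcongr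
        have := h3.trans this
        gcongr
      simp only [h2, h5]
      nlinarith [abs_nonneg (F (x - t)), abs_nonneg (F (x + t))]
    · have h2 : t⁻¹ ≤ 1 := inv_le_one_of_one_le₀ (not_le.1 h1).le
      have h3 : |F (x - t) - F (x + t)| * t⁻¹ ≤ |F (x - t) - F (x + t)| * 1 := by gcongr
      have h4 := abs_sub (F (x - t)) (F (x + t))
      linarith [hb0 t]

theorem exists_symmHilbert_bound (hF : Integrable F) (hA : ∀ x y, |F x - F y| ≤ √|x - y| * A) :
    ∃ K : ℝ, ∀ x, ∀ k : ℝ → ℝ, (∀ t, |k t| ≤ |t|⁻¹) →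
      |∫ t in Ioi 0, (F (x - t) - F (x + t)) * k t| ≤ K := by
  obtain ⟨B, K, hB, hK, hle⟩ := exists_majorant hF hA
  refine ⟨K, fun x k hk => ?_⟩
  rw [← Real.norm_eq_abs]
  refine (norm_integral_le_of_norm_le (hB x) ?_).trans (hK x)
  filter_upwards [self_mem_ae_restrict measurableSet_Ioi] with t ht
  have ht0 : (0 : ℝ) < t := ht
  rw [norm_mul, Real.norm_eq_abs, Real.norm_eq_abs]
  have h1 := hk t
  rw [abs_of_pos ht0] at h1
  exact (mul_le_mul_of_nonneg_left h1 (abs_nonneg _)).trans (hle x t ht)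

/-- Dominated convergence for any regularisation of `t⁻¹`. Sharp truncation and the conjugate
Poisson kernel are both covered, which forces their limits to agree. -/
theorem tendsto_symmHilbert (hF : Integrable F) (hA : ∀ x y, |F x - F y| ≤ √|x - y| * A)
    {k : ℝ → ℝ → ℝ} (hkm : ∀ ε > 0, Measurable (k ε)) (hk : ∀ ε > 0, ∀ t, |k ε t| ≤ |t|⁻¹)
    (hlim : ∀ t > 0, Tendsto (fun ε => k ε t) (𝓝[>] 0) (𝓝 t⁻¹)) (x : ℝ) :
    Tendsto (fun ε => ∫ t in Ioi 0, (F (x - t) - F (x + t)) * k ε t) (𝓝[>] 0)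
      (𝓝 (symmHilbert F x)) := by
  obtain ⟨B, K, hB, hK, hle⟩ := exists_majorant hF hA
  refine tendsto_integral_filter_of_dominated_convergence (B x) ?_ ?_ (hB x) ?_
  · filter_upwards [self_mem_nhdsWithin] with ε hε
    exact (((hF.comp_sub_left x).sub (hF.comp_add_left x)).aestronglyMeasurable.mul
      (hkm ε hε).aestronglyMeasurable).restrict
  · filter_upwards [self_mem_nhdsWithin] with ε hε
    filter_upwards [self_mem_ae_restrict measurableSet_Ioi] with t ht
    have ht0 : (0 : ℝ) < t := ht
    rw [norm_mul, Real.norm_eq_abs, Real.norm_eq_abs]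
    have h1 := hk ε hε t
    rw [abs_of_pos ht0] at h1
    exact (mul_le_mul_of_nonneg_left h1 (abs_nonneg _)).trans (hle x t ht)
  · filter_upwards [self_mem_ae_restrict measurableSet_Ioi] with t ht
    exact (hlim t ht).const_mul _

theorem hasHilbertTransformAt_symmHilbert (hF : Integrable F)
    (hA : ∀ x y, |F x - F y| ≤ √|x - y| * A) (x : ℝ) :
    HasHilbertTransformAt F x (1 / Real.pi * symmHilbert F x) := by
  set k : ℝ → ℝ → ℝ := fun ε => {t | ε ≤ |t|}.indicator fun t => t⁻¹ with hk
  have hm : ∀ ε : ℝ, MeasurableSet {t : ℝ | ε ≤ |t|} := fun ε =>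
    measurableSet_le measurable_const continuous_abs.measurable
  have hkm : ∀ ε, Measurable (k ε) := fun ε => measurable_inv.indicator (hm ε)
  have hkp : ∀ ε t, ε ≤ |t| → k ε t = t⁻¹ := fun ε t h => by simp [hk, h]
  have hkn : ∀ ε t, ¬ε ≤ |t| → k ε t = 0 := fun ε t h => by simp [hk, h]
  have hk1 : ∀ ε t, |k ε t| ≤ |t|⁻¹ := fun ε t => by
    by_cases h : ε ≤ |t|
    · rw [hkp ε t h, abs_inv]
    · rw [hkn ε t h, abs_zero]
      positivity
  have hk2 : ∀ ε > 0, ∀ t, |k ε t| ≤ ε⁻¹ := fun ε hε t => by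
    by_cases h : ε ≤ |t|
    · exact (hk1 ε t).trans (inv_anti₀ hε h)
    · rw [hkn ε t h, abs_zero]
      positivity
  have hodd : ∀ ε t, k ε (-t) = -k ε t := fun ε t => by
    simp only [hk, indicator, mem_ofPred_eq, abs_neg]
    split_ifs <;> simp [inv_neg]
  have hlim : ∀ t > 0, Tendsto (fun ε => k ε t) (𝓝[>] 0) (𝓝 t⁻¹) := fun t ht => by
    refine tendsto_const_nhds.congr' ?_
    filter_upwards [mem_nhdsWithin_of_mem_nhds (Iio_mem_nhds ht)] with ε hε
    exact (hkp ε t (by rw [abs_of_pos ht]; exact le_of_lt hε)).symm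
  have hms : ∀ ε : ℝ, MeasurableSet {y : ℝ | ε ≤ |x - y|} := fun ε =>
    measurableSet_le measurable_const (by fun_prop)
  have e : ∀ ε, (fun y => F y * k ε (x - y)) =
      {y | ε ≤ |x - y|}.indicator fun y => F y / (x - y) := fun ε => by
    ext y
    simp only [hk, indicator, mem_ofPred_eq, div_eq_mul_inv]
    split_ifs <;> simp
  refine ⟨fun ε hε => ?_, ?_⟩
  · rw [← integrable_indicator_iff (hms ε), ← e]
    exact integrable_mul_kernel hF (hkm ε) (hk2 ε hε) x
  · refine ((tendsto_symmHilbert hF hA (fun ε _ => hkm ε) (fun ε _ => hk1 ε) hlim x).const_mul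
      (1 / Real.pi)).congr' ?_
    filter_upwards [self_mem_nhdsWithin] with ε hε
    rw [← convKernel_eq_integral_Ioi hF (hkm ε) (hk2 ε hε) (hodd ε), convKernel, e,
      integral_indicator (hms ε)]

theorem conjPoisson_neg (δ x : ℝ) : conjPoisson δ (-x) = -conjPoisson δ x := by
  simp [conjPoisson, neg_div]

theorem tendsto_convKernel_conjPoisson (hF : Integrable F)
    (hA : ∀ x y, |F x - F y| ≤ √|x - y| * A) (x : ℝ) :
    Tendsto (fun δ => convKernel (conjPoisson δ) F x) (𝓝[>] 0) (𝓝 (symmHilbert F x)) := by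
  refine (tendsto_symmHilbert hF hA (fun δ hδ => (continuous_conjPoisson hδ).measurable)
    (fun δ hδ => abs_conjPoisson_le_inv hδ) (fun t ht => ?_) x).congr' ?_
  · have h : ContinuousAt (fun δ : ℝ => conjPoisson δ t) 0 := by
      unfold conjPoisson
      exact continuousAt_const.div (by fun_prop) (by positivity)
    have h2 : conjPoisson 0 t = t⁻¹ := by
      unfold conjPoisson; field_simp; simp
    rw [← h2]
    exact h.tendsto.mono_left nhdsWithin_le_nhds
  · filter_upwards [self_mem_nhdsWithin] with δ hδ
    exact (convKernel_eq_integral_Ioi hF (continuous_conjPoisson hδ).measurable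
      (abs_conjPoisson_le hδ) (conjPoisson_neg δ) x).symm

theorem exists_convKernel_conjPoisson_bound (hF : Integrable F)
    (hA : ∀ x y, |F x - F y| ≤ √|x - y| * A) :
    ∃ K : ℝ, ∀ δ > 0, ∀ x, |convKernel (conjPoisson δ) F x| ≤ K := by
  obtain ⟨K, hK⟩ := exists_symmHilbert_bound hF hA
  refine ⟨K, fun δ hδ x => ?_⟩
  rw [convKernel_eq_integral_Ioi hF (continuous_conjPoisson hδ).measurable
      (abs_conjPoisson_le hδ) (conjPoisson_neg δ) x]
  exact hK x _ (abs_conjPoisson_le_inv hδ)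

end PrincipalValue

/-! ### Weak compactness in a Hilbert space -/

section WeakLimit

/-- Banach–Alaoglu transported by the Riesz isomorphism. An ultrafilter takes the place of a
subsequence, so separability plays no role. -/
theorem exists_weak_limit {E ι : Type*} [NormedAddCommGroup E] [InnerProductSpace ℝ E]
    [CompleteSpace E] {l : Filter ι} [l.NeBot] {G : ι → E} {R : ℝ} (hG : ∀ᶠ i in l, ‖G i‖ ≤ R) :
    ∃ g : E, ‖g‖ ≤ R ∧ ∃ U : Ultrafilter ι, (U : Filter ι) ≤ l ∧
      ∀ m : E →L[ℝ] ℝ, Tendsto (fun i => m (G i)) U (𝓝 (m g)) := by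
  set U := Ultrafilter.of l
  have hU : (U : Filter ι) ≤ l := Ultrafilter.of_le l
  set D : ι → WeakDual ℝ E := fun i => StrongDual.toWeakDual (InnerProductSpace.toDual ℝ E (G i))
  have hc := WeakDual.isCompact_closedBall (0 : StrongDual ℝ E) R
  obtain ⟨a, ha, hlim⟩ := hc.ultrafilter_le_nhds (U.map D) (by
    rw [le_principal_iff]
    refine hU ?_
    filter_upwards [hG] with i hi
    simpa [D] using hi)
  set g := (InnerProductSpace.toDual ℝ E).symm (WeakDual.toStrongDual a)
  have hga : ∀ z, inner ℝ g z = a z := fun z => by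
    simp only [g, InnerProductSpace.toDual_symm_apply]; rfl
  refine ⟨g, ?_, U, hU, fun m => ?_⟩
  · simpa [g] using ha
  · set z := (InnerProductSpace.toDual ℝ E).symm m
    have hz : ∀ w, m w = inner ℝ w z := fun w => by
      rw [real_inner_comm]
      simp only [z, InnerProductSpace.toDual_symm_apply]
    simp only [hz]
    rw [hga]
    exact ((WeakDual.eval_continuous z).tendsto a).comp hlim

end WeakLimit

/-! ### The Hilbert transform on `H¹(ℝ)` -/

section HilbertTransform

theorem eLpNorm_two_toReal_sq {f : ℝ → ℝ} (hf : MemLp f 2) :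
    (eLpNorm f 2 volume).toReal ^ 2 = ∫ x, f x ^ 2 := by
  have h1 : ‖hf.toLp f‖ ^ 2 = ∫ x, (hf.toLp f) x * f x := by
    rw [← real_inner_self_eq_norm_sq, H1.inner_toLp hf]
  rw [Lp.norm_toLp] at h1
  rw [h1]
  refine integral_congr_ae ?_
  filter_upwards [hf.coeFn_toLp] with x hx
  rw [hx, sq]

theorem memLp_convKernel {f k : ℝ → ℝ} {C : ℝ} (hf : Integrable f) (hk : Continuous k)
    (hb : ∀ x, |k x| ≤ C) (hk2 : MemLp k 2) : MemLp (convKernel k f) 2 :=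
  (memLp_two_iff_integrable_sq (continuous_convKernel hf hk hb).aestronglyMeasurable).2
    (integrable_convKernel_sq hf hk hk2)

theorem eLpNorm_conjPoisson_le {f : ℝ → ℝ} {δ : ℝ} (hδ : 0 < δ) (hf : Integrable f)
    (hf2 : MemLp f 2) :
    (eLpNorm (convKernel (conjPoisson δ) f) 2 volume).toReal ≤
      Real.pi * (eLpNorm f 2 volume).toReal := by
  refine le_of_sq_le_sq ?_ (by positivity)
  rw [mul_pow, eLpNorm_two_toReal_sq hf2, eLpNorm_two_toReal_sq (memLp_convKernel hf
    (continuous_conjPoisson hδ) (abs_conjPoisson_le hδ) (memLp_conjPoisson hδ))]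
  exact integral_conjPoisson_sq_le hδ hf hf2

/-- The Hilbert transform of an integrable element of `H¹(ℝ)` with integrable derivative exists
almost everywhere as a principal value, and belongs to `H¹(ℝ)`. -/
theorem H1.exists_hilbert (h : H1) (hi : Integrable h) (hi' : Integrable h.wderiv) :
    ∃ G : H1, ‖G‖ ≤ ‖h‖ ∧ ∀ᵐ x : ℝ, HasHilbertTransformAt h x (G x) := by
  have hF : Integrable h.rep := hi.congr h.ae_eq_rep
  have hA : ∀ x y, |h.rep x - h.rep y| ≤ √|x - y| * (eLpNorm h.wderiv 2 volume).toReal :=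
    h.isPrimitive_rep.abs_sub_le h.memLp_wderiv
  have m1 : ∀ δ > 0, MemLp (convKernel (conjPoisson δ) h.rep) 2 volume := fun δ hδ =>
    memLp_convKernel hF (continuous_conjPoisson hδ) (abs_conjPoisson_le hδ) (memLp_conjPoisson hδ)
  have m2 : ∀ δ > 0, MemLp (convKernel (conjPoisson δ) h.wderiv) 2 volume := fun δ hδ =>
    memLp_convKernel hi' (continuous_conjPoisson hδ) (abs_conjPoisson_le hδ) (memLp_conjPoisson hδ)
  have w : ∀ δ > 0, IsWeakDeriv (convKernel (conjPoisson δ) h.rep)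
      (convKernel (conjPoisson δ) h.wderiv) := fun δ hδ =>
    isWeakDeriv_convKernel hF hi' h.isPrimitive_rep.isWeakDeriv (continuous_conjPoisson hδ)
      (abs_conjPoisson_le hδ)
  classical
  set G : ℝ → H1 := fun δ => if hδ : 0 < δ then mk (m1 δ hδ) (m2 δ hδ) (w δ hδ) else 0 with hG
  have hGe : ∀ δ > 0, G δ =ᵐ[volume] convKernel (conjPoisson δ) h.rep := fun δ hδ => by
    simp only [hG, dif_pos hδ]
    exact coe_mk _ _ _
  have hGe' : ∀ δ > 0, (G δ).wderiv =ᵐ[volume] convKernel (conjPoisson δ) h.wderiv :=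
    fun δ hδ => by
      simp only [hG, dif_pos hδ]
      exact wderiv_mk _ _ _
  have hnorm : ∀ δ > 0, ‖G δ‖ ≤ Real.pi * ‖h‖ := fun δ hδ => by
    refine le_of_sq_le_sq ?_ (by positivity)
    rw [mul_pow, norm_sq, norm_sq, mul_add]
    have n1 := eLpNorm_conjPoisson_le hδ hF h.memLp_rep
    have n2 := eLpNorm_conjPoisson_le hδ hi' h.memLp_wderiv
    rw [← eLpNorm_congr_ae (hGe δ hδ), ← eLpNorm_congr_ae h.ae_eq_rep] at n1
    rw [← eLpNorm_congr_ae (hGe' δ hδ)] at n2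
    rw [eLpNorm_toReal, eLpNorm_toReal] at n1
    rw [eLpNorm_wderiv_toReal, eLpNorm_wderiv_toReal] at n2
    rw [← mul_pow, ← mul_pow]
    gcongr
  -- Pointwise convergence alone does not produce a weak derivative in `L²`; the weak limit lies in
  -- `H1` and inherits the norm bound.
  obtain ⟨g, hg, U, hU, hlim⟩ := exists_weak_limit (l := 𝓝[>] (0 : ℝ)) (G := G)
    (R := Real.pi * ‖h‖) (by filter_upwards [self_mem_nhdsWithin] with δ hδ using hnorm δ hδ)
  obtain ⟨K, hK⟩ := exists_convKernel_conjPoisson_bound hF hA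
  have hpt := tendsto_convKernel_conjPoisson hF hA
  have hcont : ∀ δ > 0, Continuous (convKernel (conjPoisson δ) h.rep) := fun δ hδ =>
    continuous_convKernel hF (continuous_conjPoisson hδ) (abs_conjPoisson_le hδ)
  have hSb : ∀ x, |symmHilbert h.rep x| ≤ K := fun x =>
    le_of_tendsto (hpt x).abs
      (by filter_upwards [self_mem_nhdsWithin] with δ hδ using hK δ hδ x)
  have hSm : AEStronglyMeasurable (symmHilbert h.rep) volume := by
    obtain ⟨s, -, hs0, hs⟩ := exists_seq_strictAnti_tendsto (0 : ℝ)
    exact aestronglyMeasurable_of_tendsto_ae atTop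
      (fun n => (hcont (s n) (hs0 n)).aestronglyMeasurable) (ae_of_all _ fun x =>
        (hpt x).comp (tendsto_nhdsWithin_iff.2 ⟨hs, Eventually.of_forall hs0⟩))
  have hSl : LocallyIntegrable (symmHilbert h.rep) :=
    (memLp_top_of_bound hSm K (ae_of_all _ hSb)).locallyIntegrable le_top
  -- The two limits are identified by testing: pairing with `φ` is continuous on `H1`, and the
  -- uniform bound `K` permits dominated convergence on the other side.
  have hgS : ∀ᵐ x : ℝ, g x = symmHilbert h.rep x := by
    refine ae_eq_of_integral_contDiff_smul_eq (g.memLp.locallyIntegrable one_le_two) hSl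
      fun φ hφ hs => ?_
    have hφ2 : MemLp φ 2 volume := hφ.continuous.memLp_of_hasCompactSupport hs
    have hφi : Integrable φ := hφ.continuous.integrable_of_hasCompactSupport hs
    set m : H1 →L[ℝ] ℝ := (innerSL ℝ (hφ2.toLp φ)).comp
      ((WithLp.fstL 2 ℝ L2 L2).comp sobolevH1.subtypeL) with hm
    have hmz : ∀ z : H1, m z = ∫ x, φ x * z x := fun z => by
      refine (inner_toLp hφ2 z.1.fst).trans ?_
      simp only [mul_comm]
    have h1 := hlim m
    simp only [hmz] at h1
    have h2 : Tendsto (fun δ => ∫ x, φ x * G δ x) (𝓝[>] 0)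
        (𝓝 (∫ x, φ x * symmHilbert h.rep x)) := by
      have h3 : Tendsto (fun δ => ∫ x, φ x * convKernel (conjPoisson δ) h.rep x) (𝓝[>] 0)
          (𝓝 (∫ x, φ x * symmHilbert h.rep x)) := by
        refine tendsto_integral_filter_of_dominated_convergence (fun x => ‖φ x‖ * K) ?_ ?_
          (hφi.norm.mul_const K) (ae_of_all _ fun x => (hpt x).const_mul _)
        · filter_upwards [self_mem_nhdsWithin] with δ hδ
          exact (hφ.continuous.mul (hcont δ hδ)).aestronglyMeasurable
        · filter_upwards [self_mem_nhdsWithin] with δ hδ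
          refine ae_of_all _ fun x => ?_
          rw [norm_mul]
          exact mul_le_mul_of_nonneg_left (hK δ hδ x) (norm_nonneg _)
      refine h3.congr' ?_
      filter_upwards [self_mem_nhdsWithin] with δ hδ
      refine integral_congr_ae ?_
      filter_upwards [hGe δ hδ] with x hx
      rw [hx]
    simp only [smul_eq_mul]
    exact tendsto_nhds_unique h1 (h2.mono_left hU)
  refine ⟨(1 / Real.pi) • g, ?_, ?_⟩
  · rw [norm_smul, Real.norm_of_nonneg (by positivity), one_div, inv_mul_le_iff₀ Real.pi_pos]
    exact hg
  · filter_upwards [hgS, coe_smul (1 / Real.pi) g] with x hx hx'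
    rw [hx', hx]
    exact (hasHilbertTransformAt_symmHilbert hF hA x).congr h.ae_eq_rep.symm

end HilbertTransform

/-! ### The system as a quadratic equation on `H¹ × H¹` -/

section System

namespace H1

theorem norm_mul_le' (u w : H1) : ‖mul u w‖ ≤ 8 * ‖u‖ * ‖w‖ := by
  have h1 := mul_le_mul_of_nonneg_right u.supNorm_le (norm_nonneg w)
  have h2 := mul_le_mul_of_nonneg_right w.supNorm_le (norm_nonneg u)
  linarith [norm_mul_le u w]

/-- Multiplication on `H¹(ℝ)` as a bounded bilinear map. -/
noncomputable def mulL : H1 →L[ℝ] H1 →L[ℝ] H1 :=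
  LinearMap.mkContinuous₂ (LinearMap.mk₂ ℝ mul
    (fun u u' w => ext_of_ae (by
      filter_upwards [coe_mul (u + u') w, coe_add u u', coe_add (mul u w) (mul u' w),
        coe_mul u w, coe_mul u' w] with x h1 h2 h3 h4 h5
      rw [h1, h2, h3, h4, h5]; ring))
    (fun c u w => ext_of_ae (by
      filter_upwards [coe_mul (c • u) w, coe_smul c u, coe_smul c (mul u w),
        coe_mul u w] with x h1 h2 h3 h4
      rw [h1, h2, h3, h4]; ring))
    (fun u w w' => ext_of_ae (by
      filter_upwards [coe_mul u (w + w'), coe_add w w', coe_add (mul u w) (mul u w'),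
        coe_mul u w, coe_mul u w'] with x h1 h2 h3 h4 h5
      rw [h1, h2, h3, h4, h5]; ring))
    (fun c u w => ext_of_ae (by
      filter_upwards [coe_mul u (c • w), coe_smul c w, coe_smul c (mul u w),
        coe_mul u w] with x h1 h2 h3 h4
      rw [h1, h2, h3, h4]; ring))) 8 norm_mul_le'

theorem exists_hilbert_mul (u w : H1) : ∃ G : H1, ‖G‖ ≤ ‖mul u w‖ ∧
    ∀ᵐ x : ℝ, HasHilbertTransformAt (fun y => u y * w y) x (G x) := by
  obtain ⟨G, h1, h2⟩ := (mul u w).exists_hilbert (integrable_mul u w) (integrable_wderiv_mul u w)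
  refine ⟨G, h1, ?_⟩
  filter_upwards [h2] with x hx
  exact hx.congr (coe_mul u w)

/-- The Hilbert transform of the product of two elements of `H¹(ℝ)`. -/
noncomputable def hilbertMul (u w : H1) : H1 := (exists_hilbert_mul u w).choose

theorem norm_hilbertMul_le (u w : H1) : ‖hilbertMul u w‖ ≤ ‖mul u w‖ :=
  (exists_hilbert_mul u w).choose_spec.1

theorem hilbertMul_spec (u w : H1) :
    ∀ᵐ x : ℝ, HasHilbertTransformAt (fun y => u y * w y) x (hilbertMul u w x) :=
  (exists_hilbert_mul u w).choose_spec.2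

/-- Principal values are unique limits. Hence the chosen transform is canonical, and its bilinearity
follows from linearity of principal values. -/
theorem eq_hilbertMul {u w G : H1}
    (h : ∀ᵐ x : ℝ, HasHilbertTransformAt (fun y => u y * w y) x (G x)) : G = hilbertMul u w :=
  ext_of_ae (by
    filter_upwards [h, hilbertMul_spec u w] with x h1 h2
    exact h1.unique h2)

theorem add_hilbertMul {a b c d p q : H1}
    (h : (fun y => a y * b y + c y * d y) =ᵐ[volume] fun y => p y * q y) :
    hilbertMul p q = hilbertMul a b + hilbertMul c d :=
  (eq_hilbertMul (by
    filter_upwards [hilbertMul_spec a b, hilbertMul_spec c d,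
      coe_add (hilbertMul a b) (hilbertMul c d)] with x h1 h2 h3
    rw [h3]
    exact (h1.add h2).congr h)).symm

theorem smul_hilbertMul {a b p q : H1} (r : ℝ)
    (h : (fun y => r * (a y * b y)) =ᵐ[volume] fun y => p y * q y) :
    hilbertMul p q = r • hilbertMul a b :=
  (eq_hilbertMul (by
    filter_upwards [hilbertMul_spec a b, coe_smul r (hilbertMul a b)] with x h1 h2
    rw [h2]
    exact (h1.const_mul r).congr h)).symm

/-- The map `(u, w) ↦ H(u w)` on `H¹(ℝ)` as a bounded bilinear map. -/
noncomputable def hilbertMulL : H1 →L[ℝ] H1 →L[ℝ] H1 :=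
  LinearMap.mkContinuous₂ (LinearMap.mk₂ ℝ hilbertMul
    (fun u u' w => add_hilbertMul (by
      filter_upwards [coe_add u u'] with x h1
      rw [h1]; ring))
    (fun c u w => smul_hilbertMul c (by
      filter_upwards [coe_smul c u] with x h1
      rw [h1]; ring))
    (fun u w w' => add_hilbertMul (by
      filter_upwards [coe_add w w'] with x h1
      rw [h1]; ring))
    (fun c u w => smul_hilbertMul c (by
      filter_upwards [coe_smul c w] with x h1
      rw [h1]; ring))) 8
    fun u w => (norm_hilbertMul_le u w).trans (norm_mul_le' u w)

end H1

open ContinuousLinearMap in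
/-- The pair of two bilinear maps on a product, the first one in mixed components and the second
one in the first components. -/
noncomputable def pairBilinear {X : Type*} [NormedAddCommGroup X] [NormedSpace ℝ X]
    (A B : X →L[ℝ] X →L[ℝ] X) : (X × X) →L[ℝ] (X × X) →L[ℝ] (X × X) :=
  (compL ℝ (X × X) X (X × X) (inl ℝ X X)).comp (A.bilinearComp (fst ℝ X X) (snd ℝ X X)) +
    (compL ℝ (X × X) X (X × X) (inr ℝ X X)).comp (B.bilinearComp (fst ℝ X X) (fst ℝ X X))

theorem pairBilinear_apply {X : Type*} [NormedAddCommGroup X] [NormedSpace ℝ X]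
    (A B : X →L[ℝ] X →L[ℝ] X) (z w : X × X) :
    pairBilinear A B z w = (A z.1 w.2, B z.1 w.1) := by
  simp [pairBilinear]

/-- The bilinear map whose diagonal is the right-hand side of the system. -/
noncomputable def systemL : (H1 × H1) →L[ℝ] (H1 × H1) →L[ℝ] (H1 × H1) :=
  pairBilinear ((2 : ℝ) • H1.mulL) H1.hilbertMulL

theorem systemL_apply (z : H1 × H1) :
    systemL z z = ((2 : ℝ) • H1.mul z.1 z.2, H1.hilbertMul z.1 z.1) :=
  pairBilinear_apply _ _ z z

/-- In the second component the transform is removed by its `H1` bound before the product estimate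
is used, so no sup bound for a Hilbert transform enters. -/
theorem norm_systemL_le (z : H1 × H1) :
    ‖systemL z z‖ ≤ 4 * (z.1.supNorm + z.2.supNorm) * ‖z‖ := by
  rw [systemL_apply]
  have h1 : ‖z.1‖ ≤ ‖z‖ := norm_fst_le z
  have h2 : ‖z.2‖ ≤ ‖z‖ := norm_snd_le z
  have m11 := mul_le_mul_of_nonneg_left h1 z.1.supNorm_nonneg
  have m12 := mul_le_mul_of_nonneg_left h2 z.1.supNorm_nonneg
  have m21 := mul_le_mul_of_nonneg_left h1 z.2.supNorm_nonneg
  have m0 := mul_nonneg z.2.supNorm_nonneg (norm_nonneg z)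
  refine max_le ?_ ?_
  · simp only [norm_smul, Real.norm_ofNat]
    linarith [H1.norm_mul_le z.1 z.2]
  · simp only
    linarith [H1.norm_mul_le z.1 z.1, H1.norm_hilbertMul_le z.1 z.1]

variable {u₀ v₀ : H1} {T : ℝ}

/-- The almost-everywhere equations determine the time derivatives as elements of `H1`, because the
functions, and the principal values, do. -/
theorem IsSolution.hasDerivWithinAt {u v : ℝ → H1} (h : IsSolution u₀ v₀ T u v) {t : ℝ}
    (ht : t ∈ Ico 0 T) :
    HasDerivWithinAt (fun t => (u t, v t)) (systemL (u t, v t) (u t, v t)) (Ico 0 T) t := by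
  have hu := (h.contDiffOn_u.differentiableOn one_ne_zero t ht).hasDerivWithinAt
  have hv := (h.contDiffOn_v.differentiableOn one_ne_zero t ht).hasDerivWithinAt
  have eu : derivWithin u (Ico 0 T) t = (2 : ℝ) • H1.mul (u t) (v t) := H1.ext_of_ae (by
    filter_upwards [h.eq_u t ht, H1.coe_smul 2 (H1.mul (u t) (v t)), H1.coe_mul (u t) (v t)]
      with x h1 h2 h3
    rw [h1, h2, h3]; ring)
  have ev : derivWithin v (Ico 0 T) t = H1.hilbertMul (u t) (u t) := H1.eq_hilbertMul (by
    filter_upwards [h.eq_v t ht] with x hx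
    simpa only [sq] using hx)
  rw [systemL_apply]
  rw [eu] at hu
  rw [ev] at hv
  exact hu.prodMk hv

theorem isSolution_of_hasDerivWithinAt {z : ℝ → H1 × H1}
    (h : ∀ t ∈ Ico 0 T, HasDerivWithinAt z (systemL (z t) (z t)) (Ico 0 T) t) :
    IsSolution (z 0).1 (z 0).2 T (fun t => (z t).1) (fun t => (z t).2) := by
  have hu : UniqueDiffOn ℝ (Ico 0 T) := uniqueDiffOn_Ico 0 T
  have hd : ∀ t ∈ Ico 0 T, derivWithin z (Ico 0 T) t = systemL (z t) (z t) := fun t ht =>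
    (h t ht).derivWithin (hu t ht)
  have hc : ContinuousOn z (Ico 0 T) := fun t ht => (h t ht).continuousWithinAt
  have hz : ContDiffOn ℝ 1 z (Ico 0 T) := by
    rw [contDiffOn_one_iff_derivWithin hu]
    refine ⟨fun t ht => (h t ht).differentiableWithinAt, ?_⟩
    -- The `C¹` property is automatic: the derivative is a continuous expression in the continuous
    -- curve `z`.
    exact ((systemL.continuous.comp_continuousOn hc).clm_apply hc).congr hd
  have h1 : ∀ t ∈ Ico 0 T, HasDerivWithinAt (fun t => (z t).1) (systemL (z t) (z t)).1
      (Ico 0 T) t := fun t ht =>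
    (ContinuousLinearMap.fst ℝ H1 H1).hasFDerivAt.comp_hasDerivWithinAt t (h t ht)
  have h2 : ∀ t ∈ Ico 0 T, HasDerivWithinAt (fun t => (z t).2) (systemL (z t) (z t)).2
      (Ico 0 T) t := fun t ht =>
    (ContinuousLinearMap.snd ℝ H1 H1).hasFDerivAt.comp_hasDerivWithinAt t (h t ht)
  refine ⟨contDiff_fst.comp_contDiffOn hz, contDiff_snd.comp_contDiffOn hz, fun t ht => ?_,
    fun t ht => ?_, rfl, rfl⟩
  · rw [(h1 t ht).derivWithin (hu t ht), systemL_apply]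
    filter_upwards [H1.coe_smul 2 (H1.mul (z t).1 (z t).2), H1.coe_mul (z t).1 (z t).2]
      with x h1 h2
    rw [h1, h2]; ring
  · rw [(h2 t ht).derivWithin (hu t ht), systemL_apply]
    filter_upwards [H1.hilbertMul_spec (z t).1 (z t).1] with x hx
    simpa only [sq] using hx

theorem exists_local_solution :
    ∃ τ : ℝ → ℝ → ℝ, ∀ u₀ v₀ : H1, 0 < τ ‖u₀‖ ‖v₀‖ ∧
      ∃ u v : ℝ → H1, IsSolution u₀ v₀ (τ ‖u₀‖ ‖v₀‖) u v := by
  choose τ hτ H using fun M : ℝ => exists_quadratic_solution systemL M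
  refine ⟨fun a b => τ (max a b), fun u₀ v₀ => ⟨hτ _, ?_⟩⟩
  -- The product carries the maximum norm, so the norm of the datum is exactly `max ‖u₀‖ ‖v₀‖`.
  obtain ⟨z, hz0, hz⟩ := H (max ‖u₀‖ ‖v₀‖) (u₀, v₀) le_rfl 0
  rw [zero_add] at hz
  have := isSolution_of_hasDerivWithinAt (T := τ (max ‖u₀‖ ‖v₀‖)) fun t ht =>
    (hz t (Ico_subset_Icc_self ht)).mono Ico_subset_Icc_self
  rw [hz0] at this
  exact ⟨_, _, this⟩

theorem IsSolution.unique {u v u' v' : ℝ → H1} (h : IsSolution u₀ v₀ T u v)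
    (h' : IsSolution u₀ v₀ T u' v') : EqOn u u' (Ico 0 T) ∧ EqOn v v' (Ico 0 T) := by
  have key := quadratic_solution_unique systemL (fun t ht => h.hasDerivWithinAt ht)
    (fun t ht => h'.hasDerivWithinAt ht)
    (by rw [h.init_u, h.init_v, h'.init_u, h'.init_v])
  exact ⟨fun t ht => congrArg Prod.fst (key ht), fun t ht => congrArg Prod.snd (key ht)⟩

theorem IsMaximalSolution.lintegral_eq_top {u v : ℝ → H1} (h : IsMaximalSolution u₀ v₀ T u v) :
    ∫⁻ t in Ico 0 T, (eLpNorm (u t) ⊤ volume + eLpNorm (v t) ⊤ volume) = ⊤ := by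
  obtain ⟨hT, hsol, hmax⟩ := h
  by_contra hfin
  have hd := fun t (ht : t ∈ Ico 0 T) => hsol.hasDerivWithinAt ht
  set a : ℝ → ℝ := fun t => 4 * ((u t).supNorm + (v t).supNorm) with ha
  have ha0 : ∀ t, 0 ≤ a t := fun t => by
    have := (u t).supNorm_nonneg
    have := (v t).supNorm_nonneg
    positivity
  have hac : ContinuousOn a (Ico 0 T) := continuousOn_const.mul
    ((H1.continuous_supNorm.comp_continuousOn hsol.contDiffOn_u.continuousOn).add
      (H1.continuous_supNorm.comp_continuousOn hsol.contDiffOn_v.continuousOn))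
  have hai : IntegrableOn a (Ico 0 T) := by
    refine ⟨hac.aestronglyMeasurable measurableSet_Ico, ?_⟩
    rw [hasFiniteIntegral_iff_ofReal (ae_of_all _ ha0)]
    have e : ∀ t, ENNReal.ofReal (a t) =
        4 * (eLpNorm (u t) ⊤ volume + eLpNorm (v t) ⊤ volume) := fun t => by
      rw [ENNReal.ofReal_mul (by norm_num), ENNReal.ofReal_add (u t).supNorm_nonneg
        (v t).supNorm_nonneg, H1.ofReal_supNorm, H1.ofReal_supNorm, ENNReal.ofReal_ofNat]
    simp only [e]
    rw [lintegral_const_mul' _ _ (by norm_num)]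
    exact ENNReal.mul_lt_top (by norm_num) (lt_top_iff_ne_top.2 hfin)
  -- A finite integral makes the rate `a` integrable, so Grönwall bounds the solution up to `T`; the
  -- continuation it then admits contradicts maximality.
  obtain ⟨M, hM⟩ := exists_bound_of_norm_deriv_le_mul hd hac (fun t _ => ha0 t) hai
    fun t _ => norm_systemL_le (u t, v t)
  obtain ⟨S, hS, y, hy0, hy⟩ := exists_quadratic_extension systemL hT hd hM
  have := isSolution_of_hasDerivWithinAt hy
  rw [hy0, hsol.init_u, hsol.init_v] at this
  exact hmax S hS ⟨_, _, this⟩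

end System

end NonlocalSystem

theorem mainTheorem5 :
    -- local existence, on a time interval that depends on the norms of the data only
    (∃ τ : ℝ → ℝ → ℝ, ∀ u₀ v₀ : NonlocalSystem.H1,
      0 < τ ‖u₀‖ ‖v₀‖ ∧
      ∃ u v : ℝ → NonlocalSystem.H1,
        NonlocalSystem.IsSolution u₀ v₀ (τ ‖u₀‖ ‖v₀‖) u v) ∧
    -- uniqueness, on every interval of existence
    (∀ (u₀ v₀ : NonlocalSystem.H1) (T : ℝ) (u v u' v' : ℝ → NonlocalSystem.H1),
      NonlocalSystem.IsSolution u₀ v₀ T u v →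
      NonlocalSystem.IsSolution u₀ v₀ T u' v' →
      EqOn u u' (Ico 0 T) ∧ EqOn v v' (Ico 0 T)) ∧
    -- blow-up criterion
    (∀ (u₀ v₀ : NonlocalSystem.H1) (T : ℝ) (u v : ℝ → NonlocalSystem.H1),
      NonlocalSystem.IsMaximalSolution u₀ v₀ T u v →
      ∫⁻ t in Ico 0 T, (eLpNorm (u t) ⊤ volume + eLpNorm (v t) ⊤ volume) = ⊤) :=
  ⟨NonlocalSystem.exists_local_solution, fun _ _ _ _ _ _ _ h h' => h.unique h',
    fun _ _ _ _ _ h => h.lintegral_eq_top⟩
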